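/- Conventions. Let $K$ be a connected graph with its path metric. $K$ is hyperbolic if there is $\delta$ such that each side of each geodesic triangle lies in the $\delta$-neighbourhood of the union of the other two sides; $K$ is fine if for every $n$ each edge lies in only finitely many embedded loops of length $n$. A group $G$ is hyperbolic if it has a finite generating set $S$ whose Cayley graph is hyperbolic. For a collection $\mathscr{G}$ of subgroups of $G$, the coned-off graph of $\mathrm{Cay}(G,S)$ has vertex set $G\sqcup\bigsqcup_{K\in\mathscr{G}}G/K$, and its edges are those of $\mathrm{Cay}(G,S)$ together with an edge joining $g$ to $gK$ for all $g\in G$ and $K\in\mathscr{G}$; $G$ is hyperbolic relative to $\mathscr{G}$ if for some finite generating set $S$ this graph is fine and hyperbolic. For a subgroup $H<G$, a set $F\subset G\setminus H$ is $H$-roaming if there is an infinite sequence $(h_k)_{k\ge 0}$ in $H$ with $h_kFh_k^{-1}\cap h_lFh_l^{-1}=\emptyset$ for all $k\neq l$. Complements are taken in $G$: $F^c=G\setminus F$. Proposition. Let $G$ be a group and $H$ an infinite subgroup of $G$. (1) (Hyperbolic case.) Suppose that $G$ is hyperbolic and that $H$ is a maximal amenable subgroup of $G$. Then for all $s,t\in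 G\setminus H$ there is an $H$-roaming set $F\subset G\setminus H$ such that $sF^ct\cap F^c$ is finite. (2) (Relatively hyperbolic case.) Suppose that $G$ is hyperbolic relative to a collection $\mathscr{G}$ of subgroups and that $H\in\mathscr{G}$. Then for all $s,t\in G\setminus H$ there is an $H$-roaming set $F\subset G\setminus H$ such that $sF^ct\cap F^c$ is finite. Moreover, $F$ can be chosen so that in addition $sF^ct\cap F^c\subset H$, and hence $s(F\cup H)^ct\subset F\cup H$. -/

import Mathlib

namespace RelHyp

universe u

/-! ### Hyperbolic and fine graphs -/

section Graphs

variable {V : Type u}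

/-- A path is geodesic if its length is the distance between its endpoints. -/
def IsGeodesic (K : SimpleGraph V) {x y : V} (p : K.Walk x y) : Prop :=
  p.length = K.dist x y

/-- Gromov hyperbolicity of a connected graph: for some `δ`, every side of every geodesic triangle
lies in the `δ`-neighbourhood of the union of the two other sides. -/
def IsHyperbolicGraph (K : SimpleGraph V) : Prop :=
  K.Connected ∧ ∃ δ : ℕ, ∀ (x y z : V) (p : K.Walk x y) (q : K.Walk y z) (r : K.Walk z x),
    IsGeodesic K p → IsGeodesic K q → IsGeodesic K r →
      (∀ v ∈ p.support, ∃ w, (w ∈ q.support ∨ w ∈ r.support) ∧ K.dist v w ≤ δ) ∧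
      (∀ v ∈ q.support, ∃ w, (w ∈ r.support ∨ w ∈ p.support) ∧ K.dist v w ≤ δ) ∧
      (∀ v ∈ r.support, ∃ w, (w ∈ p.support ∨ w ∈ q.support) ∧ K.dist v w ≤ δ)

/-- A graph is fine if, for each `n`, every edge is contained in only finitely many
embedded loops of length `n`. -/
def IsFineGraph (K : SimpleGraph V) : Prop :=
  ∀ e ∈ K.edgeSet, ∀ n : ℕ,
    {c : Σ v : V, K.Walk v v | c.2.IsCycle ∧ c.2.length = n ∧ e ∈ c.2.edges}.Finite

end Graphs

section Groups

variable {G : Type u} [Group G]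

/-! ### Hyperbolic and relatively hyperbolic groups -/

/-- A group is hyperbolic if its Cayley graph for some finite generating set is hyperbolic. -/
def IsHyperbolicGroup (G : Type u) [Group G] : Prop :=
  ∃ S : Finset G, Subgroup.closure (S : Set G) = ⊤ ∧
    IsHyperbolicGraph (SimpleGraph.mulCayley (S : Set G))

/-- The vertices of the coned-off graph: the elements of `G`, and the left cosets of each
subgroup belonging to the family `P`. -/
abbrev ConedOffVertex (P : Set (Subgroup G)) : Type u :=
  G ⊕ (Σ K : P, G ⧸ (K : Subgroup G))

/-- Adjacency in the coned-off graph: the edges of the Cayley graph, and an edge between each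
left coset and each of its elements. -/
def conedOffAdj (S : Set G) (P : Set (Subgroup G)) :
    ConedOffVertex P → ConedOffVertex P → Prop
  | .inl a, .inl b => (SimpleGraph.mulCayley S).Adj a b
  | .inl a, .inr c => (QuotientGroup.mk a : G ⧸ (c.1 : Subgroup G)) = c.2
  | .inr c, .inl a => (QuotientGroup.mk a : G ⧸ (c.1 : Subgroup G)) = c.2
  | .inr _, .inr _ => False

/-- The coned-off graph of the Cayley graph of `G` for `S`, with respect to the family `P`. -/
def conedOff (S : Set G) (P : Set (Subgroup G)) : SimpleGraph (ConedOffVertex P) where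
  Adj := conedOffAdj S P
  symm := ⟨by
    rintro (a | c) (b | d) h
    · exact SimpleGraph.Adj.symm (G := SimpleGraph.mulCayley S) h
    · exact h
    · exact h
    · exact h⟩
  loopless := ⟨by
    rintro (a | c) h
    · exact SimpleGraph.irrefl (G := SimpleGraph.mulCayley S) h
    · exact h⟩

/-- `G` is hyperbolic relative to the family `P` of subgroups: for some finite generating set, the
coned-off graph is fine and hyperbolic. -/
def IsRelHyperbolic (P : Set (Subgroup G)) : Prop :=
  ∃ S : Finset G, Subgroup.closure (S : Set G) = ⊤ ∧
    IsFineGraph (conedOff (S : Set G) P) ∧ IsHyperbolicGraph (conedOff (S : Set G) P)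

/-! ### Amenability -/

/-- A discrete group is amenable if it carries a left-invariant finitely additive probability
measure defined on all of its subsets. -/
def IsAmenable (Γ : Type u) [Group Γ] : Prop :=
  ∃ μ : Set Γ → ℝ, (∀ A, 0 ≤ μ A) ∧ μ Set.univ = 1 ∧
    (∀ A B, Disjoint A B → μ (A ∪ B) = μ A + μ B) ∧
    ∀ (g : Γ) (A : Set Γ), μ ((fun x => g * x) '' A) = μ A

/-- `H` is maximal among the amenable subgroups of `G`. -/
def IsMaximalAmenable (H : Subgroup G) : Prop :=
  Maximal (fun K : Subgroup G => IsAmenable K) H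

/-! ### Roaming sets -/

/-- `F` is `H`-roaming: `F ⊆ G ∖ H`, and there is a sequence in `H` such that the corresponding
conjugates of `F` are pairwise disjoint. -/
def IsRoaming (H : Subgroup G) (F : Set G) : Prop :=
  F ⊆ (H : Set G)ᶜ ∧ ∃ h : ℕ → G, (∀ k, h k ∈ H) ∧ ∀ k l, k ≠ l →
    Disjoint ((fun x => h k * x * (h k)⁻¹) '' F) ((fun x => h l * x * (h l)⁻¹) '' F)

/-- The two-sided translate `s A t`. -/
def translate (s : G) (A : Set G) (t : G) : Set G :=
  (fun x => s * x * t) '' A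

end Groups

end RelHyp

/-!
Both cases rest on one mechanism, a coarse projection `π : G → H` (`IsCoarseProjection`): it is
`H`-equivariant, it moves boundedly under right translations, it is uniformly bounded on each
coset `gH ≠ H`, and `x`, `s * x` cannot both project far away when `s ∉ H`. For a finite set `A ⊆
H` put `F = {g ∉ H | π g ∈ A}`. Conjugation by `h ∈ H` moves the projections of elements of `F`
into `h A B` for a fixed finite set `B`, so `F` is roaming because `H` is infinite. If `x ∉ F`,
then, up to finitely many `x ∈ H`, the projection of `x` is not in `A`; for large `A` the
projection of `s * x * t` is therefore confined to a fixed finite set `A'`, and if `A` contains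
`A'` as well, `s * x * t` lies in `F` or is one of finitely many elements of `H`. This is
`IsCoarseProjection.exists_roaming`; enlarging `A` once more absorbs the exceptions outside `H`.

In the relatively hyperbolic case, the neighbours in the coned-off graph of the cone vertex `v` of
`H` are the elements of `H`, and `π x` is the first vertex of a geodesic from `v` to `x`. Two
neighbours of `v` make angle at most `n` if a walk of length at most `n` avoiding `v` joins them.
Fineness makes this angle locally finite (`IsFineGraph.finite_joinedOff`). Hyperbolicity makes the
angle between the first vertices of geodesics from `v` to `a` and `b` bounded unless every
geodesic from `a` to `b` passes through `v` (`joinedOff_of_isGeodesic`); a short walk off `v` from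
`a` to `b` bounds it too (`JoinedOff.first_vertices`).

In the hyperbolic case, thin triangles give the four-point inequality for the word metric. An
infinite subgroup contains a loxodromic element `g` (`IsHypMetric.exists_isLoxodromic`): otherwise
all its elements point in one direction, and far out in this direction they all displace a point
by a bounded amount, which contradicts properness. The four-point inequality shows that the powers
of `g` form a contracting quasigeodesic. Let `E` be the commensurator of `⟨g⟩`. It lies in a
neighbourhood of `⟨g⟩`, and the translates of `⟨g⟩` by elements outside `E` have bounded
projections to `⟨g⟩`, because a long overlap would, by the pigeonhole principle, conjugate a power
of `g` to another one. Thus the projection to `E` is coarse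
(`IsHypMetric.exists_isCoarseProjection`). An amenable `H` containing `g` lies in `E`: for `s ∈ H
\ E`, a set `U` of elements with bounded projection would have infinitely many disjoint
translates, hence mean zero, whereas `s` maps the complement of `U` into `U`. Moreover `H` has
finite index in `E`, so `E` is amenable and maximality gives `H = E`.
-/

namespace RelHyp

/-! ### Coarse projections -/

section CoarseProjection

variable {G : Type*} [Group G] {H : Subgroup G}

/-- A coarse projection of `G` onto `H`: an `H`-equivariant map moving boundedly (that is, by
finitely many elements of `H`) along right translations, uniformly boundedly on the cosets `gH`
other than `H`, and such that `x` and `s * x` cannot both project far away when `s ∉ H`. -/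
structure IsCoarseProjection (H : Subgroup G) (π : G → H) : Prop where
  equivariant : ∀ (h : H) (x : G), π (h * x) = h * π x
  finite_coset : {b : H | ∃ g : G, g ∉ H ∧ ∃ k : H, (π g)⁻¹ * π (g * k) = b}.Finite
  finite_right : ∀ t : G, {b : H | ∃ x : G, (π x)⁻¹ * π (x * t) = b}.Finite
  finite_left : ∀ s : G, s ∉ H →
    ∃ A B : Set H, A.Finite ∧ B.Finite ∧ ∀ x, π x ∉ A → π (s * x) ∈ B

/-- Infinitely many elements of an infinite set translate a given finite set to pairwise disjoint
sets. -/
theorem exists_pairwise_disjoint_translates {Γ : Type*} [Group Γ] {T C : Set Γ}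
    (hT : T.Infinite) (hC : C.Finite) :
    ∃ h : ℕ → Γ, (∀ k, h k ∈ T) ∧ ∀ k l, k ≠ l → ∀ a ∈ C, ∀ b ∈ C, h k * a ≠ h l * b := by
  have : Std.Symm fun x y : Γ => ∀ a ∈ C, ∀ b ∈ C, x * a ≠ y * b :=
    ⟨fun x y h a ha b hb => (h b hb a ha).symm⟩
  obtain ⟨f, hfT, hf⟩ := exists_seq_of_forall_finset_exists' (fun x : Γ => x ∈ T)
    (fun x y => ∀ a ∈ C, ∀ b ∈ C, x * a ≠ y * b)
    (fun s _ => by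
      have hfin : (⋃ x ∈ s, ((fun p : Γ × Γ => x * p.1 * p.2⁻¹) '' (C ×ˢ C))).Finite :=
        s.finite_toSet.biUnion fun x _ => (hC.prod hC).image _
      obtain ⟨y, hyT, hy⟩ := (hT.sdiff hfin).nonempty
      exact ⟨y, hyT, fun x hx a ha b hb h =>
        hy (Set.mem_biUnion hx ⟨(a, b), ⟨ha, hb⟩, by simp [h]⟩)⟩)
  exact ⟨f, hfT, fun k l hkl => hf hkl⟩

/-- An `H`-invariant relation between `G` and `H` contains the graph of an `H`-equivariant map,
because `H` acts freely on `G`. -/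
theorem exists_equivariant_choice (P : G → H → Prop)
    (hP : ∀ (h : H) x k, P x k → P (h * x) (h * k)) (hex : ∀ x, ∃ k, P x k) :
    ∃ π : G → H, (∀ (h : H) x, π (h * x) = h * π x) ∧ ∀ x, P x (π x) := by
  choose c hc using hex
  let r : G → G := fun x => (Quotient.mk (QuotientGroup.rightRel H) x).out
  have hr : ∀ x, x * (r x)⁻¹ ∈ H := fun x =>
    QuotientGroup.rightRel_apply.1 (Quotient.exact (Quotient.out_eq (Quotient.mk _ x)))
  have hrh : ∀ (h : H) x, r (h * x) = r x := fun h x => by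
    have : Quotient.mk (QuotientGroup.rightRel H) (h * x) = Quotient.mk _ x :=
      Quotient.sound (QuotientGroup.rightRel_apply.2 (by simp))
    simp only [r, this]
  refine ⟨fun x => ⟨x * (r x)⁻¹, hr x⟩ * c (r x), fun h x => ?_, fun x => ?_⟩
  · rw [← mul_assoc]
    ext
    simp [hrh, mul_assoc]
  · simpa using hP ⟨x * (r x)⁻¹, hr x⟩ (r x) _ (hc (r x))

/-- The set of elements outside `H` projecting into a fixed finite subset of `H` is roaming. -/
theorem IsCoarseProjection.isRoaming {π : G → H} (hπ : IsCoarseProjection H π) [Infinite H]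
    {A : Set H} (hA : A.Finite) : IsRoaming H {g : G | g ∉ H ∧ π g ∈ A} := by
  obtain ⟨h, -, hh⟩ := exists_pairwise_disjoint_translates (Set.infinite_univ (α := H))
    ((hA.prod hπ.finite_coset).image fun p : H × H => p.1 * p.2)
  have key : ∀ (k : H) (g : G), g ∉ H → π g ∈ A → ∃ c ∈ (fun p : H × H => p.1 * p.2) ''
      (A ×ˢ {b : H | ∃ g : G, g ∉ H ∧ ∃ k : H, (π g)⁻¹ * π (g * k) = b}),
      π (k * g * (k : G)⁻¹) = k * c := by
    intro k g hg hgA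
    refine ⟨_, ⟨(π g, (π g)⁻¹ * π (g * (k⁻¹ : H))), ⟨hgA, g, hg, k⁻¹, rfl⟩, rfl⟩, ?_⟩
    simp [mul_assoc, ← hπ.equivariant]
  refine ⟨fun g hg => hg.1, fun k => h k, fun k => (h k).2, fun k l hkl => ?_⟩
  rw [Set.disjoint_left]
  rintro _ ⟨g, ⟨hg, hgA⟩, rfl⟩ ⟨g', ⟨hg', hgA'⟩, hgg'⟩
  obtain ⟨c, hc, hc'⟩ := key (h k) g hg hgA
  obtain ⟨d, hd, hd'⟩ := key (h l) g' hg' hgA'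
  apply hh k l hkl c hc d hd
  rw [← hc', ← hd']
  exact (congrArg π hgg').symm

/-- The roaming set is the set of elements outside `H` whose projection lies in a large finite
set. -/
theorem IsCoarseProjection.exists_roaming {π : G → H} (hπ : IsCoarseProjection H π) [Infinite H]
    {s : G} (hs : s ∉ H) (t : G) :
    ∃ F : Set G, IsRoaming H F ∧ (translate s Fᶜ t ∩ Fᶜ).Finite ∧
      translate s Fᶜ t ∩ Fᶜ ⊆ (H : Set G) ∧
      translate s (F ∪ (H : Set G))ᶜ t ⊆ F ∪ (H : Set G) := by
  obtain ⟨A, B, hA, hB, hAB⟩ := hπ.finite_left s hs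
  have hBt : ((fun p : H × H => p.1 * p.2) '' (B ×ˢ
      {b : H | ∃ x : G, (π x)⁻¹ * π (x * t) = b})).Finite :=
    (hB.prod (hπ.finite_right t)).image _
  set B' := (fun p : H × H => p.1 * p.2) '' (B ×ˢ
      {b : H | ∃ x : G, (π x)⁻¹ * π (x * t) = b})
  have hB' : ∀ x, π x ∉ A → π (s * x * t) ∈ B' := fun x hx =>
    ⟨(π (s * x), (π (s * x))⁻¹ * π (s * x * t)), ⟨hAB x hx, s * x, rfl⟩, by simp⟩
  let F : Set H → Set G := fun C => {g : G | g ∉ H ∧ π g ∈ C}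
  have hπH : ∀ h : H, π h = h * π 1 := fun h => by simpa using hπ.equivariant h 1
  have hfin : ∀ C : Set H, A ∪ B' ⊆ C → (translate s (F C)ᶜ t ∩ (F C)ᶜ).Finite := by
    intro C hC
    -- The exceptions are the products `s * x * t` with `x ∈ H` projecting to `A`, and the
    -- elements of `H` projecting to `B'`.
    have h1 : ((fun a : H => s * ((a * (π 1)⁻¹ : H) : G) * t) '' A).Finite := hA.image _
    have h2 : ((fun b : H => ((b * (π 1)⁻¹ : H) : G)) '' B').Finite := hBt.image _
    refine (h1.union h2).subset ?_
    rintro _ ⟨⟨x, hx, rfl⟩, hy⟩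
    by_cases hxA : π x ∈ A
    · left
      have hxH : x ∈ H := by
        by_contra hxH
        exact hx ⟨hxH, hC (Or.inl hxA)⟩
      refine ⟨π x, hxA, ?_⟩
      have := hπH ⟨x, hxH⟩
      simp only at this
      simp [this]
    · right
      have hyB := hB' x hxA
      have hyH : s * x * t ∈ H := by
        by_contra hyH
        exact hy ⟨hyH, hC (Or.inr hyB)⟩
      refine ⟨_, hyB, ?_⟩
      have := hπH ⟨_, hyH⟩
      simp only at this
      simp [this]
  -- Enlarging the finite set absorbs the finitely many exceptions outside `H`.
  let E : Set G := translate s (F (A ∪ B'))ᶜ t ∩ (F (A ∪ B'))ᶜ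
  let C : Set H := A ∪ B' ∪ π '' E
  have hC : C.Finite := (hA.union hBt).union ((hfin _ subset_rfl).image π)
  have hFC : F (A ∪ B') ⊆ F C := fun g hg => ⟨hg.1, Or.inl hg.2⟩
  have hsub : translate s (F C)ᶜ t ∩ (F C)ᶜ ⊆ (H : Set G) := by
    rintro y ⟨⟨x, hx, rfl⟩, hy⟩
    by_contra hyH
    exact hy ⟨hyH, Or.inr ⟨_, ⟨⟨x, fun h => hx (hFC h), rfl⟩, fun h => hy (hFC h)⟩, rfl⟩⟩
  refine ⟨F C, hπ.isRoaming hC, hfin C Set.subset_union_left, hsub, ?_⟩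
  rintro _ ⟨x, hx, rfl⟩
  by_cases hy : s * x * t ∈ F C
  · exact Or.inl hy
  · exact Or.inr (hsub ⟨⟨x, fun h => hx (Or.inl h), rfl⟩, hy⟩)

end CoarseProjection

/-! ### Geodesics in hyperbolic graphs -/

section Geodesics

variable {V : Type*} {K : SimpleGraph V}

/-- Geodesic triangles of `K` are `δ`-thin; by symmetry it suffices to treat one side. -/
def IsThin (K : SimpleGraph V) (δ : ℕ) : Prop :=
  ∀ (x y z : V) (p : K.Walk x y) (q : K.Walk y z) (r : K.Walk z x),
    IsGeodesic K p → IsGeodesic K q → IsGeodesic K r →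
      ∀ w ∈ p.support, ∃ w', (w' ∈ q.support ∨ w' ∈ r.support) ∧ K.dist w w' ≤ δ

theorem IsHyperbolicGraph.exists_isThin (h : IsHyperbolicGraph K) : ∃ δ, IsThin K δ := by
  obtain ⟨-, δ, hδ⟩ := h
  exact ⟨δ, fun x y z p q r hp hq hr => (hδ x y z p q r hp hq hr).1⟩

theorem IsGeodesic.reverse {x y : V} {p : K.Walk x y} (hp : IsGeodesic K p) :
    IsGeodesic K p.reverse := by
  rw [IsGeodesic, SimpleGraph.Walk.length_reverse, hp, SimpleGraph.dist_comm]

theorem exists_isGeodesic (hK : K.Connected) (x y : V) : ∃ p : K.Walk x y, IsGeodesic K p :=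
  hK.exists_walk_length_eq_dist x y

theorem IsGeodesic.dist_add_dist (hK : K.Connected) {x y w : V} {p : K.Walk x y}
    (hp : IsGeodesic K p) (hw : w ∈ p.support) : K.dist x w + K.dist w y = K.dist x y := by
  obtain ⟨q, r, rfl⟩ := SimpleGraph.Walk.mem_support_iff_exists_append.1 hw
  have h1 := SimpleGraph.dist_le q
  have h2 := SimpleGraph.dist_le r
  have h3 := hK.dist_triangle (u := x) (v := w) (w := y)
  rw [IsGeodesic, SimpleGraph.Walk.length_append] at hp
  omega

theorem IsGeodesic.exists_mem_support (hK : K.Connected) {x y : V} {p : K.Walk x y}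
    (hp : IsGeodesic K p) {n : ℕ} (hn : n ≤ K.dist x y) : ∃ w ∈ p.support, K.dist x w = n := by
  refine ⟨p.getVert n, p.getVert_mem_support n, ?_⟩
  have h := hp.dist_add_dist hK (p.getVert_mem_support n)
  have h1 := SimpleGraph.dist_le (p.take n)
  have h2 := SimpleGraph.dist_le (p.drop n)
  rw [SimpleGraph.Walk.take_length] at h1
  rw [SimpleGraph.Walk.drop_length] at h2
  rw [IsGeodesic] at hp
  omega

theorem IsGeodesic.cons {v u a : V} (h : K.Adj v u) {p : K.Walk u a} (hp : IsGeodesic K p)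
    (hu : K.dist u a + 1 = K.dist v a) : IsGeodesic K (SimpleGraph.Walk.cons h p) := by
  rw [IsGeodesic, SimpleGraph.Walk.length_cons, hp, hu]

/-- Every vertex `a ≠ v` is reached from `v` through a first vertex. -/
theorem exists_adj_dist_add_one (hK : K.Connected) {v a : V} (hva : v ≠ a) :
    ∃ u, K.Adj v u ∧ K.dist u a + 1 = K.dist v a := by
  obtain ⟨p, hp⟩ := exists_isGeodesic hK v a
  cases p with
  | nil => exact absurd rfl hva
  | @cons _ u _ h q =>
    refine ⟨u, h, ?_⟩
    have h1 := SimpleGraph.dist_le q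
    have h2 := hK.dist_triangle (u := v) (v := u) (w := a)
    rw [SimpleGraph.dist_eq_one_iff_adj.2 h] at h2
    rw [IsGeodesic, SimpleGraph.Walk.length_cons] at hp
    omega

end Geodesics

/-! ### Angles at a vertex -/

section Angles

variable {V : Type*} {K : SimpleGraph V} {v : V}

/-- `a` and `b` are joined by a walk of length at most `n` which avoids `v`. For neighbours `a`, `b`
of `v` this says that the angle at `v` between `a` and `b` is at most `n`. -/
def JoinedOff (K : SimpleGraph V) (v : V) (n : ℕ) (a b : V) : Prop :=
  ∃ p : K.Walk a b, v ∉ p.support ∧ p.length ≤ n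

theorem JoinedOff.refl {a : V} (h : v ≠ a) (n : ℕ) : JoinedOff K v n a a :=
  ⟨.nil, by simpa using h, by simp⟩

theorem JoinedOff.symm {n : ℕ} {a b : V} (h : JoinedOff K v n a b) : JoinedOff K v n b a := by
  obtain ⟨p, hp, hn⟩ := h
  exact ⟨p.reverse, by simpa using hp, by simpa using hn⟩

theorem JoinedOff.trans {m n : ℕ} {a b c : V} (h : JoinedOff K v m a b)
    (h' : JoinedOff K v n b c) : JoinedOff K v (m + n) a c := by
  obtain ⟨p, hp, hm⟩ := h
  obtain ⟨q, hq, hn⟩ := h'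
  refine ⟨p.append q, ?_, ?_⟩
  · rw [SimpleGraph.Walk.mem_support_append_iff]
    tauto
  · rw [SimpleGraph.Walk.length_append]
    omega

theorem JoinedOff.mono {m n : ℕ} {a b : V} (h : JoinedOff K v m a b) (hmn : m ≤ n) :
    JoinedOff K v n a b := by
  obtain ⟨p, hp, hm⟩ := h
  exact ⟨p, hp, hm.trans hmn⟩

theorem JoinedOff.of_adj {a b : V} (h : K.Adj a b) (ha : v ≠ a) (hb : v ≠ b) :
    JoinedOff K v 1 a b :=
  ⟨.cons h .nil, by simp [ha, hb], by simp⟩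

theorem JoinedOff.of_dist_lt (hK : K.Connected) {a b : V} (h : K.dist a b < K.dist a v) :
    JoinedOff K v (K.dist a b) a b := by
  obtain ⟨p, hp⟩ := exists_isGeodesic hK a b
  refine ⟨p, fun hv => ?_, hp.le⟩
  have := hp.dist_add_dist hK hv
  omega

theorem JoinedOff.of_mem_support (hK : K.Connected) {x y a b : V} {p : K.Walk x y}
    (hp : IsGeodesic K p) (hv : v ∉ p.support) (ha : a ∈ p.support) (hb : b ∈ p.support) :
    JoinedOff K v (K.dist a b) a b := by
  obtain ⟨q, r, rfl⟩ := SimpleGraph.Walk.mem_support_iff_exists_append.1 ha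
  rw [SimpleGraph.Walk.mem_support_append_iff] at hb hv
  rw [IsGeodesic, SimpleGraph.Walk.length_append] at hp
  rcases hb with hb | hb
  · obtain ⟨q, s, rfl⟩ := SimpleGraph.Walk.mem_support_iff_exists_append.1 hb
    rw [SimpleGraph.Walk.mem_support_append_iff] at hv
    have h1 := hK.dist_triangle (u := x) (v := b) (w := y)
    have h2 := hK.dist_triangle (u := b) (v := a) (w := y)
    have h3 := SimpleGraph.dist_le q
    have h4 := SimpleGraph.dist_le r
    rw [SimpleGraph.Walk.length_append] at hp
    rw [K.dist_comm]
    exact JoinedOff.symm ⟨s, by tauto, by omega⟩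
  · obtain ⟨s, r, rfl⟩ := SimpleGraph.Walk.mem_support_iff_exists_append.1 hb
    rw [SimpleGraph.Walk.mem_support_append_iff] at hv
    have h1 := hK.dist_triangle (u := x) (v := a) (w := y)
    have h2 := hK.dist_triangle (u := a) (v := b) (w := y)
    have h3 := SimpleGraph.dist_le q
    have h4 := SimpleGraph.dist_le r
    rw [SimpleGraph.Walk.length_append] at hp
    exact ⟨s, by tauto, by omega⟩

/-- In a fine graph the angle at `v` is locally finite. -/
theorem IsFineGraph.finite_joinedOff (hK : IsFineGraph K) {u : V} (hu : K.Adj v u) (n : ℕ) :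
    {u' | K.Adj v u' ∧ JoinedOff K v n u u'}.Finite := by
  classical
  have hfin : (⋃ m ∈ Set.Iic (n + 2), {c : Σ v : V, K.Walk v v |
      c.2.IsCycle ∧ c.2.length = m ∧ s(v, u) ∈ c.2.edges}).Finite :=
    (Set.finite_Iic _).biUnion fun m _ => hK _ hu m
  refine ((hfin.image fun c => c.2.penultimate).insert u).subset ?_
  rintro u' ⟨hu', p, hp, hpn⟩
  by_cases huu : u' = u
  · exact Or.inl huu
  right
  have hvp : v ∉ p.bypass.support := fun h => hp (p.support_bypass_subset_support h)
  have hlen := p.length_bypass_le_length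
  refine ⟨⟨v, .cons hu (p.bypass.concat hu'.symm)⟩, ?_, ?_⟩
  · refine Set.mem_biUnion (x := p.bypass.length + 2) (by simp; omega) ⟨?_, ?_, ?_⟩
    · rw [SimpleGraph.Walk.cons_isCycle_iff]
      refine ⟨p.bypass_isPath.concat hvp _, ?_⟩
      rw [SimpleGraph.Walk.edges_concat, List.concat_eq_append, List.mem_append]
      rintro (h | h)
      · exact hvp (SimpleGraph.Walk.fst_mem_support_of_mem_edges _ h)
      · simp only [List.mem_singleton, Sym2.eq_iff] at h
        rcases h with ⟨rfl, -⟩ | ⟨-, h⟩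
        · exact hu'.ne rfl
        · exact huu h.symm
    · simp
    · simp
  · simp only
    rw [SimpleGraph.Walk.penultimate_cons_of_not_nil _ _
        (by simp [SimpleGraph.Walk.not_nil_iff_lt_length]),
      SimpleGraph.Walk.penultimate_concat]

/-- One half of the comparison of directions at `v`: the first vertex `u` of a geodesic from `v`
to `a` is near, off `v`, to a vertex close to `v` of the geodesic `p` from `a` to `b`, or to the
first vertex `u'` of a geodesic from `v` to `b`. -/
theorem exists_joinedOff_of_isThin (hK : K.Connected) {δ : ℕ} (hδ : IsThin K δ) {a b u u' : V}
    {p : K.Walk a b} (hp : IsGeodesic K p) (hu : K.Adj v u) (hua : K.dist u a + 1 = K.dist v a)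
    (hu' : K.Adj v u') (hub : K.dist u' b + 1 = K.dist v b) :
    (∃ w ∈ p.support, K.dist v w ≤ 2 * δ + 1 ∧ JoinedOff K v (2 * δ + 1) u w) ∨
      JoinedOff K v (4 * δ + 2) u u' := by
  obtain ⟨q, hq⟩ := exists_isGeodesic hK u a
  obtain ⟨q', hq'⟩ := exists_isGeodesic hK u' b
  -- The vertices of a geodesic starting at `v` with first vertex `x` are joined to `x` off `v`.
  have key : ∀ {x c : V} (h : K.Adj v x) (_ : K.dist x c + 1 = K.dist v c) {r : K.Walk x c}
      (_ : IsGeodesic K r) (w : V), w ∈ (SimpleGraph.Walk.cons h r).support → w ≠ v →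
      JoinedOff K v (K.dist v w) x w := by
    intro x c h hxc r hr w hw hwv
    have hw' : w ∈ r.support := by simpa [hwv] using hw
    have h1 := hr.dist_add_dist hK hw'
    have h2 := (hr.cons h hxc).dist_add_dist hK hw
    refine (JoinedOff.of_dist_lt hK ?_).symm.mono (n := K.dist v w) ?_
    · rw [K.dist_comm (u := w) (v := x), K.dist_comm (u := w) (v := v)]
      omega
    · rw [K.dist_comm (u := w) (v := x)]
      omega
  by_cases hva : K.dist v a ≤ δ
  · refine Or.inl ⟨a, p.start_mem_support, by omega, (key hu hua hq a (by simp) ?_).mono (by omega)⟩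
    rintro rfl
    simp at hua
  obtain ⟨w, hw, hvw⟩ := (hq.cons hu hua).exists_mem_support hK (n := δ + 1) (by omega)
  have hwv : w ≠ v := by
    rintro rfl
    simp at hvw
  obtain ⟨w', hw', hww'⟩ := hδ _ _ _ _ p _ (hq.cons hu hua) hp (hq'.cons hu' hub).reverse w hw
  have h1 := hK.dist_triangle (u := v) (v := w) (w := w')
  have h2 : JoinedOff K v δ w w' :=
    (JoinedOff.of_dist_lt hK (by rw [K.dist_comm (u := w) (v := v)]; omega)).mono hww'
  have h3 : JoinedOff K v (2 * δ + 1) u w' := ((key hu hua hq w hw hwv).trans h2).mono (by omega)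
  rcases hw' with hw' | hw'
  · exact Or.inl ⟨w', hw', by omega, h3⟩
  · right
    have hwv' : w' ≠ v := by
      rintro rfl
      rw [K.dist_comm] at hww'
      omega
    have hw'' : w' ∈ (SimpleGraph.Walk.cons hu' q').support := by
      rw [SimpleGraph.Walk.support_reverse, List.mem_reverse] at hw'
      exact hw'
    exact (h3.trans (key hu' hub hq' w' hw'' hwv').symm).mono (by omega)

/-- If a geodesic from `a` to `b` avoids `v`, then geodesics from `v` to `a` and to `b` make a
bounded angle at `v`. -/
theorem joinedOff_of_isGeodesic (hK : K.Connected) {δ : ℕ} (hδ : IsThin K δ) {a b u u' : V}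
    {p : K.Walk a b} (hp : IsGeodesic K p) (hv : v ∉ p.support) (hu : K.Adj v u)
    (hua : K.dist u a + 1 = K.dist v a) (hu' : K.Adj v u') (hub : K.dist u' b + 1 = K.dist v b) :
    JoinedOff K v (8 * δ + 4) u u' := by
  rcases exists_joinedOff_of_isThin hK hδ hp hu hua hu' hub with ⟨w, hw, hvw, h⟩ | h
  · rcases exists_joinedOff_of_isThin hK hδ hp.reverse hu' hub hu hua with ⟨w', hw', hvw', h'⟩ | h'
    · have h1 := hK.dist_triangle (u := w) (v := v) (w := w')
      rw [K.dist_comm (u := w) (v := v)] at h1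
      exact ((h.trans (JoinedOff.of_mem_support hK hp hv hw (by simpa using hw'))).trans
        h'.symm).mono (by omega)
    · exact h'.symm.mono (by omega)
  · exact h.mono (by omega)

/-- If `a` and `b` are joined by a walk of length at most `n` avoiding `v`, then geodesics from
`v` to `a` and to `b` make a bounded angle at `v`. -/
theorem JoinedOff.first_vertices (hK : K.Connected) {δ : ℕ} (hδ : IsThin K δ) {n : ℕ} {a b u u' : V}
    (hab : JoinedOff K v n a b) (hu : K.Adj v u)
    (hua : K.dist u a + 1 = K.dist v a) (hu' : K.Adj v u') (hub : K.dist u' b + 1 = K.dist v b) :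
    JoinedOff K v (8 * δ + 4 + 3 * n) u u' := by
  obtain ⟨p, hp⟩ := exists_isGeodesic hK a b
  by_cases hv : v ∈ p.support
  · have h1 := hp.dist_add_dist hK hv
    have h2 : K.dist a b ≤ n := by
      obtain ⟨q, -, hq⟩ := hab
      exact (SimpleGraph.dist_le q).trans hq
    have key : ∀ {x c : V}, K.dist x c + 1 = K.dist v c → JoinedOff K v (K.dist v c) x c := by
      intro x c hxc
      have h3 := K.dist_comm (u := c) (v := x)
      have h4 := K.dist_comm (u := c) (v := v)
      exact (JoinedOff.of_dist_lt hK (a := c) (b := x) (by omega)).symm.mono (by omega)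
    rw [K.dist_comm (u := a) (v := v)] at h1
    exact (((key hua).trans hab).trans (key hub).symm).mono (by omega)
  · exact (joinedOff_of_isGeodesic hK hδ hp hv hu hua hu' hub).mono (by omega)

end Angles

/-! ### The coarse projection of a relatively hyperbolic group onto a peripheral subgroup -/

section ConedOff

variable {G : Type*} [Group G]

theorem dist_le_dist_of_hom {V W : Type*} {K : SimpleGraph V} {L : SimpleGraph W}
    (hK : K.Connected) (f : K →g L) (x y : V) : L.dist (f x) (f y) ≤ K.dist x y := by
  obtain ⟨p, hp⟩ := exists_isGeodesic hK x y
  simpa using (SimpleGraph.dist_le (p.map f)).trans_eq ((p.length_map f).trans hp)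

/-- The action of `G` on the vertices of the coned-off graph by left translation. -/
def conedOffAct (P : Set (Subgroup G)) (g : G) : ConedOffVertex P → ConedOffVertex P
  | .inl x => .inl (g * x)
  | .inr ⟨K, c⟩ => .inr ⟨K, g • c⟩

/-- Left translation by `g` as a graph homomorphism of the coned-off graph. -/
def conedOffHom (S : Set G) (P : Set (Subgroup G)) (g : G) : conedOff S P →g conedOff S P where
  toFun := conedOffAct P g
  map_rel' := by
    rintro (a | ⟨K, c⟩) (b | ⟨L, d⟩) h
    · exact SimpleGraph.mulCayley_adj_mul_iff_right.2 h
    · exact (congrArg (g • ·) h :)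
    · exact (congrArg (g • ·) h :)
    · exact h

variable {S : Set G} {P : Set (Subgroup G)}

theorem conedOffAct_inl (g x : G) : conedOffAct P g (.inl x) = .inl (g * x) := rfl

theorem conedOffAct_mul (g h : G) (x : ConedOffVertex P) :
    conedOffAct P (g * h) x = conedOffAct P g (conedOffAct P h x) := by
  rcases x with x | ⟨K, c⟩
  · simp [conedOffAct, mul_assoc]
  · simp [conedOffAct, mul_smul]

theorem conedOffAct_one (x : ConedOffVertex P) : conedOffAct P 1 x = x := by
  rcases x with x | ⟨K, c⟩ <;> simp [conedOffAct]

theorem conedOffAct_inv_act (g : G) (x : ConedOffVertex P) :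
    conedOffAct P g⁻¹ (conedOffAct P g x) = x := by
  rw [← conedOffAct_mul, inv_mul_cancel, conedOffAct_one]

theorem dist_conedOffAct (hK : (conedOff S P).Connected) (g : G) (x y : ConedOffVertex P) :
    (conedOff S P).dist (conedOffAct P g x) (conedOffAct P g y) = (conedOff S P).dist x y := by
  refine (dist_le_dist_of_hom hK (conedOffHom S P g) x y).antisymm ?_
  have := dist_le_dist_of_hom hK (conedOffHom S P g⁻¹) (conedOffAct P g x) (conedOffAct P g y)
  simpa [conedOffHom, conedOffAct_inv_act] using this

theorem JoinedOff.conedOffAct {v x y : ConedOffVertex P} {n : ℕ}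
    (h : JoinedOff (conedOff S P) v n x y) (g : G) :
    JoinedOff (conedOff S P) (conedOffAct P g v) n (conedOffAct P g x) (conedOffAct P g y) := by
  obtain ⟨p, hp, hn⟩ := h
  refine ⟨p.map (conedOffHom S P g), fun hv => hp ?_, (p.length_map _).trans_le hn⟩
  replace hv : RelHyp.conedOffAct P g v ∈ (p.map (conedOffHom S P g)).support := hv
  rw [SimpleGraph.Walk.support_map, List.mem_map] at hv
  obtain ⟨w, hw, hwv⟩ := hv
  have := congrArg (RelHyp.conedOffAct P g⁻¹) hwv
  rw [conedOffAct_inv_act] at this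
  rwa [← this, show (conedOffHom S P g) w = RelHyp.conedOffAct P g w from rfl, conedOffAct_inv_act]

/-- The cone vertex of the trivial coset of `H`. -/
def coneVertex {H : Subgroup G} (hH : H ∈ P) : ConedOffVertex P :=
  .inr ⟨⟨H, hH⟩, (QuotientGroup.mk 1 : G ⧸ H)⟩

variable {H : Subgroup G} (hH : H ∈ P)

theorem conedOffAct_coneVertex_eq_iff (g : G) :
    conedOffAct P g (coneVertex hH) = coneVertex hH ↔ g ∈ H := by
  simp only [conedOffAct, coneVertex, Sum.inr.injEq, Sigma.mk.injEq, heq_eq_eq, true_and]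
  change (QuotientGroup.mk (g * 1) : G ⧸ H) = QuotientGroup.mk 1 ↔ g ∈ H
  rw [eq_comm, QuotientGroup.eq]
  simp

theorem adj_coneVertex_inl_iff (g : G) :
    (conedOff S P).Adj (coneVertex hH) (.inl g) ↔ g ∈ H := by
  change (QuotientGroup.mk g : G ⧸ H) = QuotientGroup.mk 1 ↔ g ∈ H
  rw [eq_comm, QuotientGroup.eq]
  simp

theorem exists_eq_inl_of_adj_coneVertex {u : ConedOffVertex P}
    (hu : (conedOff S P).Adj (coneVertex hH) u) : ∃ h : H, u = .inl (h : G) := by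
  rcases u with g | c
  · exact ⟨⟨g, (adj_coneVertex_inl_iff hH g).1 hu⟩, rfl⟩
  · exact hu.elim

theorem finite_joinedOff_coneVertex (hfine : IsFineGraph (conedOff S P)) (k : H) (n : ℕ) :
    {h : H | JoinedOff (conedOff S P) (coneVertex hH) n (.inl (k : G)) (.inl (h : G))}.Finite := by
  have h1 := hfine.finite_joinedOff ((adj_coneVertex_inl_iff (S := S) hH (k : G)).2 k.2) n
  refine (h1.preimage (f := fun h : H => (Sum.inl (h : G) : ConedOffVertex P)) ?_).subset ?_
  · intro x _ y _ hxy
    exact Subtype.ext (Sum.inl_injective hxy)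
  · exact fun h hh => ⟨(adj_coneVertex_inl_iff hH (h : G)).2 h.2, hh⟩

/-- A right translation moves the vertices of the Cayley graph boundedly in the complement of every
cone vertex. -/
theorem exists_joinedOff_mul_right (hS : Subgroup.closure S = ⊤) (t : G) :
    ∃ n, ∀ x : G, JoinedOff (conedOff S P) (coneVertex hH) n (.inl x) (.inl (x * t)) := by
  have hne : ∀ x : G, coneVertex hH ≠ (.inl x : ConedOffVertex P) := fun x => Sum.inr_ne_inl
  induction (hS ▸ Subgroup.mem_top t : t ∈ Subgroup.closure S) using
    Subgroup.closure_induction with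
  | mem s hs =>
    refine ⟨1, fun x => ?_⟩
    by_cases h1 : s = 1
    · simpa [h1] using JoinedOff.refl (hne x) 1
    · refine JoinedOff.of_adj ?_ (hne _) (hne _)
      exact (SimpleGraph.mulCayley_adj S _ _).2 ⟨by simpa using h1, by simp [hs]⟩
  | one => exact ⟨0, fun x => by simpa using JoinedOff.refl (hne x) 0⟩
  | mul s t _ _ hs ht =>
    obtain ⟨m, hm⟩ := hs
    obtain ⟨n, hn⟩ := ht
    exact ⟨m + n, fun x => (hm x).trans (by simpa [mul_assoc] using hn (x * s))⟩
  | inv s _ hs =>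
    obtain ⟨n, hn⟩ := hs
    exact ⟨n, fun x => by simpa using (hn (x * s⁻¹)).symm⟩

/-- The projection to a peripheral subgroup `H` sends `x` to the first vertex of a geodesic from the
cone vertex of `H` to `x`. -/
theorem IsRelHyperbolic.exists_isCoarseProjection (hP : IsRelHyperbolic P) (hH : H ∈ P) :
    ∃ π : G → H, IsCoarseProjection H π := by
  obtain ⟨S, hS, hfine, hhyp⟩ := hP
  have hK := hhyp.1
  obtain ⟨δ, hδ⟩ := hhyp.exists_isThin
  set K := conedOff (S : Set G) P with hKdef
  let v := coneVertex hH
  have hvH : ∀ h : H, conedOffAct P (h : G) v = v := fun h =>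
    (conedOffAct_coneVertex_eq_iff hH (h : G)).2 h.2
  have hadj : ∀ h : H, K.Adj v (.inl (h : G)) := fun h => (adj_coneVertex_inl_iff hH _).2 h.2
  obtain ⟨π, hequiv, hπ⟩ := exists_equivariant_choice
    (fun (x : G) (k : H) => K.dist (.inl (k : G)) (.inl x) + 1 = K.dist v (.inl x))
    (fun h x k hk => by
      rw [← dist_conedOffAct hK (h : G), ← dist_conedOffAct hK (h : G) v, hvH] at hk
      exact hk)
    (fun x => by
      obtain ⟨u, hu, hux⟩ := exists_adj_dist_add_one hK (v := v) (a := .inl x) Sum.inr_ne_inl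
      obtain ⟨k, rfl⟩ := exists_eq_inl_of_adj_coneVertex hH hu
      exact ⟨k, hux⟩)
  -- The angle at `v` between elements of `H` is invariant under `H`.
  have htrans : ∀ (k l : H) (n : ℕ), JoinedOff K v n (.inl (k : G)) (.inl (l : G)) →
      JoinedOff K v n (.inl ((1 : H) : G)) (.inl ((k⁻¹ * l : H) : G)) := by
    intro k l n h
    have := h.conedOffAct ((k⁻¹ : H) : G)
    rw [hvH] at this
    simpa [conedOffAct] using this
  refine ⟨π, hequiv, ?_, fun t => ?_, fun s hs => ?_⟩
  · refine (finite_joinedOff_coneVertex hH hfine 1 (8 * δ + 4 + 3 * 2)).subset ?_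
    rintro _ ⟨g, hg, k, rfl⟩
    refine htrans _ _ _ (JoinedOff.first_vertices hK hδ ?_ (hadj _) (hπ g) (hadj _) (hπ _))
    -- The vertices `g` and `g * k` are joined by a path through the cone vertex of `g * H`.
    have hne : v ≠ conedOffAct P g v := fun h =>
      hg ((conedOffAct_coneVertex_eq_iff hH g).1 h.symm)
    have hgk : ∀ k : H, K.Adj (conedOffAct P g v) (.inl (g * k)) := fun k =>
      (conedOffHom (S : Set G) P g).map_adj (hadj k)
    have h1 := (JoinedOff.of_adj (hgk 1) hne Sum.inr_ne_inl).symm.trans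
      (JoinedOff.of_adj (hgk k) hne Sum.inr_ne_inl)
    simpa using h1
  · obtain ⟨n, hn⟩ := exists_joinedOff_mul_right (S := (S : Set G)) hH hS t
    refine (finite_joinedOff_coneVertex hH hfine 1 (8 * δ + 4 + 3 * n)).subset ?_
    rintro _ ⟨x, rfl⟩
    exact htrans _ _ _ (JoinedOff.first_vertices hK hδ (hn x) (hadj _) (hπ x) (hadj _) (hπ _))
  · -- If the angle at `v` between `s⁻¹ • v` and `x` is large, the geodesic from `s⁻¹ • v` to `x`
    -- passes through `v`.
    have hne : ∀ g : G, g ∉ H → v ≠ conedOffAct P g v := fun g hg h =>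
      hg ((conedOffAct_coneVertex_eq_iff hH g).1 h.symm)
    have hfirst : ∀ g : G, g ∉ H → ∃ h : H,
        K.dist (.inl (h : G)) (conedOffAct P g v) + 1 = K.dist v (conedOffAct P g v) := by
      intro g hg
      obtain ⟨u, hu, hux⟩ := exists_adj_dist_add_one hK (hne g hg)
      obtain ⟨k, rfl⟩ := exists_eq_inl_of_adj_coneVertex hH hu
      exact ⟨k, hux⟩
    obtain ⟨a, ha⟩ := hfirst s⁻¹ (by simpa using hs)
    obtain ⟨b, hb⟩ := hfirst s hs
    refine ⟨_, _, finite_joinedOff_coneVertex hH hfine a (8 * δ + 4),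
      finite_joinedOff_coneVertex hH hfine b (8 * δ + 4 + 3 * 0), fun x hx => ?_⟩
    have h1 := hπ (s * x)
    rw [← dist_conedOffAct hK s⁻¹, ← dist_conedOffAct hK s⁻¹ v] at h1
    rw [conedOffAct_inl, conedOffAct_inl, inv_mul_cancel_left, ← hKdef] at h1
    obtain ⟨p, hp⟩ := exists_isGeodesic hK (Sum.inl (s⁻¹ * (π (s * x) : G))) (Sum.inl x)
    have hadj' : K.Adj (conedOffAct P s⁻¹ v) (.inl (s⁻¹ * (π (s * x) : G))) :=
      (conedOffHom (S : Set G) P s⁻¹).map_adj (hadj _)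
    have hgeo := hp.cons hadj' h1
    have hvp : v ∈ (SimpleGraph.Walk.cons hadj' p).support := by
      by_contra hv
      exact hx (joinedOff_of_isGeodesic hK hδ hgeo hv (hadj a) ha (hadj _) (hπ x))
    have hvp' : v ∈ p.support := by
      rw [SimpleGraph.Walk.support_cons, List.mem_cons] at hvp
      exact hvp.resolve_left (hne _ (by simpa using hs))
    have h2 := hgeo.dist_add_dist hK hvp
    have h3 := hp.dist_add_dist hK hvp'
    have h4 : K.dist (.inl (π (s * x) : G)) (conedOffAct P s v) + 1 =
        K.dist v (conedOffAct P s v) := by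
      rw [← dist_conedOffAct hK s⁻¹, ← dist_conedOffAct hK s⁻¹ v, conedOffAct_inv_act,
        conedOffAct_inl, ← hKdef]
      omega
    exact JoinedOff.first_vertices hK hδ (JoinedOff.refl (hne s hs) 0) (hadj b) hb (hadj _) h4

end ConedOff

/-! ### Word metrics of hyperbolic groups -/

section FourPoint

variable {V : Type*} {K : SimpleGraph V}

/-- A thin triangle in terms of distances: every vertex of one side almost realises the distance
between the endpoints of one of the two other sides. -/
theorem IsThin.dist_add_dist_le (hK : K.Connected) {δ : ℕ} (hδ : IsThin K δ) {x y : V}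
    {p : K.Walk x y} (hp : IsGeodesic K p) {c : V} (hc : c ∈ p.support) (z : V) :
    K.dist x c + K.dist c z ≤ K.dist x z + 2 * δ ∨
      K.dist y c + K.dist c z ≤ K.dist y z + 2 * δ := by
  obtain ⟨q, hq⟩ := exists_isGeodesic hK y z
  obtain ⟨r, hr⟩ := exists_isGeodesic hK z x
  obtain ⟨w, hw, hcw⟩ := hδ _ _ _ p q r hp hq hr c hc
  have h1 := hK.dist_triangle (u := c) (v := w) (w := z)
  have h2 := K.dist_comm (u := c) (v := w)
  rcases hw with hw | hw
  · right
    have h3 := hq.dist_add_dist hK hw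
    have h4 := hK.dist_triangle (u := y) (v := w) (w := c)
    omega
  · left
    have h3 := hr.dist_add_dist hK hw
    have h4 := hK.dist_triangle (u := x) (v := w) (w := c)
    have h5 := K.dist_comm (u := x) (v := w)
    have h6 := K.dist_comm (u := z) (v := w)
    have h7 := K.dist_comm (u := z) (v := x)
    omega

/-- A side of a thin triangle has a vertex close to both other sides. -/
theorem IsThin.exists_center (hK : K.Connected) {δ : ℕ} (hδ : IsThin K δ) {x y : V}
    {p : K.Walk x y} (hp : IsGeodesic K p) (z : V) :
    ∃ c ∈ p.support, K.dist x c + K.dist c z ≤ K.dist x z + (2 * δ + 2) ∧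
      K.dist y c + K.dist c z ≤ K.dist y z + (2 * δ + 2) := by
  by_cases h : ∃ n < p.length,
      K.dist x (p.getVert n) + K.dist (p.getVert n) z ≤ K.dist x z + 2 * δ ∧
      ¬ K.dist x (p.getVert (n + 1)) + K.dist (p.getVert (n + 1)) z ≤ K.dist x z + 2 * δ
  · obtain ⟨n, hn, h1, h2⟩ := h
    have h3 := (hδ.dist_add_dist_le hK hp (p.getVert_mem_support (n + 1)) z).resolve_left h2
    have h4 := SimpleGraph.dist_eq_one_iff_adj.2 (p.adj_getVert_succ hn)
    have h5 := hK.dist_triangle (u := p.getVert n) (v := p.getVert (n + 1)) (w := z)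
    have h6 := hK.dist_triangle (u := y) (v := p.getVert (n + 1)) (w := p.getVert n)
    rw [K.dist_comm (u := p.getVert (n + 1)) (v := p.getVert n)] at h6
    exact ⟨_, p.getVert_mem_support n, by omega, by omega⟩
  · push Not at h
    have hall : ∀ n ≤ p.length,
        K.dist x (p.getVert n) + K.dist (p.getVert n) z ≤ K.dist x z + 2 * δ := by
      intro n
      induction n with
      | zero => simp
      | succ n ih => exact fun hn => h n (by omega) (ih (by omega))
    have h1 := hall _ le_rfl
    rw [p.getVert_length] at h1
    exact ⟨y, p.end_mem_support, by omega, by simp⟩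

/-- Thin triangles imply the four-point inequality. -/
theorem IsThin.four_point (hK : K.Connected) {δ : ℕ} (hδ : IsThin K δ) (x y z w : V) :
    K.dist x y + K.dist z w ≤
      max (K.dist x z + K.dist y w) (K.dist x w + K.dist y z) + (4 * δ + 2) := by
  obtain ⟨p, hp⟩ := exists_isGeodesic hK x y
  obtain ⟨c, hc, h1, h2⟩ := hδ.exists_center hK hp z
  have h3 := hδ.dist_add_dist_le hK hp hc w
  have h4 := hp.dist_add_dist hK hc
  have h5 := hK.dist_triangle (u := z) (v := c) (w := w)
  have h6 := K.dist_comm (u := c) (v := z)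
  have h7 := K.dist_comm (u := c) (v := y)
  omega

end FourPoint

section HypMetric

variable {G : Type*} [Group G]

/-- A left-invariant pseudometric `d` on `G` with values in the natural numbers which is proper,
has points at every intermediate distance, and satisfies the four-point inequality with constant
`D`. -/
structure IsHypMetric (d : G → G → ℕ) (D : ℕ) : Prop where
  self : ∀ x, d x x = 0
  comm : ∀ x y, d x y = d y x
  triangle : ∀ x y z, d x z ≤ d x y + d y z
  left : ∀ g x y, d (g * x) (g * y) = d x y
  four : ∀ x y z w, d x y + d z w ≤ max (d x z + d y w) (d x w + d y z) + D
  finite_ball : ∀ n, {x | d 1 x ≤ n}.Finite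
  exists_between : ∀ x y n, n ≤ d x y → ∃ z, d x z = n ∧ d x z + d z y = d x y

theorem mulCayley_dist_mul_left {S : Set G} (hS : (SimpleGraph.mulCayley S).Connected) (g x y : G) :
    (SimpleGraph.mulCayley S).dist (g * x) (g * y) = (SimpleGraph.mulCayley S).dist x y := by
  have h : ∀ g x y : G, (SimpleGraph.mulCayley S).dist (g * x) (g * y) ≤
      (SimpleGraph.mulCayley S).dist x y := fun g x y =>
    dist_le_dist_of_hom hS (K := SimpleGraph.mulCayley S) (L := SimpleGraph.mulCayley S)
      ⟨fun x => g * x, fun h => SimpleGraph.mulCayley_adj_mul_iff_right.2 h⟩ x y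
  exact (h g x y).antisymm (by simpa using h g⁻¹ (g * x) (g * y))

theorem mulCayley_finite_ball {S : Set G} (hfin : S.Finite)
    (hS : (SimpleGraph.mulCayley S).Connected) (n : ℕ) :
    {x | (SimpleGraph.mulCayley S).dist 1 x ≤ n}.Finite := by
  induction n with
  | zero =>
    refine (Set.finite_singleton (1 : G)).subset fun x hx => ?_
    exact (hS.dist_eq_zero_iff.1 (Nat.le_zero.1 hx)).symm
  | succ n ih =>
    refine (ih.union ((ih.prod (hfin.union hfin.inv)).image fun p : G × G => p.1 * p.2)).subset ?_
    intro x hx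
    obtain ⟨p, hp⟩ := exists_isGeodesic hS 1 x
    by_cases hxn : (SimpleGraph.mulCayley S).dist 1 x ≤ n
    · exact Or.inl hxn
    right
    obtain ⟨z, hz, hzn⟩ := hp.exists_mem_support hS (n := n) (by omega)
    have h1 := hp.dist_add_dist hS hz
    have hx' : (SimpleGraph.mulCayley S).dist 1 x ≤ n + 1 := hx
    have h2 : (SimpleGraph.mulCayley S).dist z x = 1 := by omega
    rw [SimpleGraph.dist_eq_one_iff_adj, SimpleGraph.mulCayley_adj] at h2
    refine ⟨(z, z⁻¹ * x), ⟨hzn.le, ?_⟩, by simp⟩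
    rcases h2.2 with h | h
    · exact Or.inl h
    · exact Or.inr (by simpa using h)

theorem IsHyperbolicGroup.exists_isHypMetric (hG : IsHyperbolicGroup G) :
    ∃ (d : G → G → ℕ) (D : ℕ), IsHypMetric d D := by
  obtain ⟨S, -, hhyp⟩ := hG
  have hK := hhyp.1
  obtain ⟨δ, hδ⟩ := hhyp.exists_isThin
  refine ⟨(SimpleGraph.mulCayley (S : Set G)).dist, 4 * δ + 2, ?_⟩
  exact {
    self := fun x => SimpleGraph.dist_self
    comm := fun x y => SimpleGraph.dist_comm
    triangle := fun x y z => hK.dist_triangle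
    left := mulCayley_dist_mul_left hK
    four := hδ.four_point hK
    finite_ball := mulCayley_finite_ball S.finite_toSet hK
    exists_between := fun x y n hn => by
      obtain ⟨p, hp⟩ := exists_isGeodesic hK x y
      obtain ⟨w, hw, hwn⟩ := hp.exists_mem_support hK hn
      exact ⟨w, hwn, hp.dist_add_dist hK hw⟩ }

end HypMetric

/-! ### Loxodromic elements -/

section Loxodromic

variable {G : Type*} [Group G] {d : G → G → ℕ} {D : ℕ}

/-- A sufficient condition for the powers of `g` to form a quasigeodesic: `g ^ 2` moves the identity
definitely farther than `g` does. -/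
def IsLoxodromic (d : G → G → ℕ) (D : ℕ) (g : G) : Prop :=
  d 1 g + (2 * D + 1) ≤ d 1 (g ^ 2)

namespace IsHypMetric

theorem dist_eq_one (hd : IsHypMetric d D) (x y : G) : d x y = d 1 (x⁻¹ * y) := by
  rw [← hd.left x⁻¹ x y, inv_mul_cancel]

theorem dist_one_inv (hd : IsHypMetric d D) (x : G) : d 1 x⁻¹ = d 1 x := by
  rw [hd.comm, hd.dist_eq_one, inv_inv, mul_one]

theorem dist_mul_right (hd : IsHypMetric d D) (x y : G) : d x (x * y) = d 1 y := by
  rw [hd.dist_eq_one, inv_mul_cancel_left]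

theorem dist_one_pow_add_le (hd : IsHypMetric d D) {g : G} (hg : IsLoxodromic d D g) (n : ℕ) :
    d 1 (g ^ n) + (D + 1) ≤ d 1 (g ^ (n + 1)) := by
  rw [IsLoxodromic] at hg
  induction n with
  | zero =>
    have h1 := hd.triangle 1 g (g ^ 2)
    rw [pow_two, hd.dist_mul_right, ← pow_two] at h1
    rw [pow_zero, hd.self, zero_add, zero_add, pow_one]
    omega
  | succ n ih =>
    have h1 := hd.four 1 (g ^ 2) g (g ^ (n + 2))
    have h2 : d g (g ^ (n + 2)) = d 1 (g ^ (n + 1)) := by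
      rw [show g ^ (n + 2) = g * g ^ (n + 1) by rw [← pow_succ']]
      exact hd.dist_mul_right _ _
    have h3 : d (g ^ 2) (g ^ (n + 2)) = d 1 (g ^ n) := by
      rw [add_comm, pow_add]
      exact hd.dist_mul_right _ _
    have h4 : d (g ^ 2) g = d 1 g := by
      rw [hd.comm, pow_two]
      exact hd.dist_mul_right _ _
    rw [show n + 1 + 1 = n + 2 from rfl]
    omega

theorem dist_one_pow_mono (hd : IsHypMetric d D) {g : G} (hg : IsLoxodromic d D g) {m n : ℕ}
    (h : m ≤ n) : d 1 (g ^ m) + (n - m) ≤ d 1 (g ^ n) := by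
  induction n, h using Nat.le_induction with
  | base => simp
  | succ n hn ih =>
    have := hd.dist_one_pow_add_le hg n
    omega

theorem dist_one_pow_add_dist_one_pow (hd : IsHypMetric d D) {g : G} (hg : IsLoxodromic d D g)
    (m n : ℕ) : d 1 (g ^ m) + d 1 (g ^ n) ≤ d 1 (g ^ (m + n)) + (d 1 g + D) := by
  rcases n with _ | n
  · rw [pow_zero, hd.self]
    simp
  have h1 := hd.four 1 (g ^ (m + 1)) (g ^ m) (g ^ (m + (n + 1)))
  have h2 : d (g ^ m) (g ^ (m + (n + 1))) = d 1 (g ^ (n + 1)) := by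
    rw [pow_add, hd.dist_mul_right]
  have h3 : d (g ^ (m + 1)) (g ^ (m + (n + 1))) = d 1 (g ^ n) := by
    rw [show m + (n + 1) = m + 1 + n by ring, pow_add g (m + 1) n, hd.dist_mul_right]
  have h4 : d (g ^ (m + 1)) (g ^ m) = d 1 g := by
    rw [hd.comm, pow_succ, hd.dist_mul_right]
  have h5 := hd.dist_one_pow_add_le hg m
  have h6 := hd.dist_one_pow_add_le hg n
  omega

theorem isLoxodromic_inv (hd : IsHypMetric d D) {g : G} (hg : IsLoxodromic d D g) :
    IsLoxodromic d D g⁻¹ := by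
  rw [IsLoxodromic] at *
  rw [inv_pow, hd.dist_one_inv, hd.dist_one_inv]
  exact hg

theorem isLoxodromic_conj (hd : IsHypMetric d D) {g x : G}
    (h : d x (g * x) + (2 * D + 1) ≤ d x (g ^ 2 * x)) : IsLoxodromic d D (x⁻¹ * g * x) := by
  rw [hd.dist_eq_one, hd.dist_eq_one x] at h
  rw [IsLoxodromic]
  convert h using 2
  · group
  · simp [pow_two, mul_assoc]

/-- If no element of `H` is loxodromic, then the elements of `H` lie in a single direction. -/
theorem dist_le_max_of_forall_not_isLoxodromic (hd : IsHypMetric d D) {H : Subgroup G}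
    (hH : ∀ g ∈ H, ¬ IsLoxodromic d D g) {h k : G} (hh : h ∈ H) (hk : k ∈ H) :
    d h k ≤ max (d 1 h) (d 1 k) + (6 * D + 1) := by
  by_contra hcon
  have e1 := hH h hh
  have e2 := hH k hk
  refine hH (h⁻¹ * k) (H.mul_mem (H.inv_mem hh) hk) ?_
  simp only [IsLoxodromic] at *
  have f1 : d h h⁻¹ = d 1 (h ^ 2) := by
    rw [hd.comm, hd.dist_eq_one, inv_inv, pow_two]
  have f2 : d k k⁻¹ = d 1 (k ^ 2) := by
    rw [hd.comm, hd.dist_eq_one, inv_inv, pow_two]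
  have f3 := hd.dist_one_inv h
  have f4 := hd.dist_one_inv k
  have f5 : d 1 (h⁻¹ * k) = d h k := (hd.dist_eq_one h k).symm
  have f6 : d 1 (h⁻¹ * k)⁻¹ = d h k := by rw [hd.dist_one_inv, f5]
  have f7 : d h⁻¹ (h⁻¹ * k) = d 1 k := hd.dist_mul_right _ _
  have f8 : d k⁻¹ (h⁻¹ * k)⁻¹ = d 1 h := by
    rw [mul_inv_rev, inv_inv, hd.dist_mul_right]
  have f9 : d (h⁻¹ * k)⁻¹ (h⁻¹ * k) = d 1 ((h⁻¹ * k) ^ 2) := by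
    rw [hd.dist_eq_one, inv_inv, pow_two]
  have s2 := hd.comm h 1
  have s3 := hd.comm k 1
  have s4 := hd.comm h⁻¹ 1
  have s5 := hd.comm k⁻¹ 1
  have s7 := hd.comm (h⁻¹ * k) h⁻¹
  have s8 := hd.comm (h⁻¹ * k) 1
  have s9 := hd.comm (h⁻¹ * k)⁻¹ 1
  have s10 := hd.comm (h⁻¹ * k) (h⁻¹ * k)⁻¹
  -- First `h⁻¹` and `k⁻¹` are at least as far apart as `h` and `k`, up to a multiple of `D`.
  have g1 := hd.four h k 1 h⁻¹
  have g2 := hd.four k h⁻¹ 1 k⁻¹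
  have g3 : d h k ≤ d h⁻¹ k⁻¹ + 2 * D := by
    omega
  -- Hence `h⁻¹ * k` and its inverse start in the different directions of `h⁻¹` and `k⁻¹`.
  have g4 := hd.four (h⁻¹ * k) 1 h⁻¹ k⁻¹
  have g5 := hd.four (h⁻¹ * k) k⁻¹ (h⁻¹ * k)⁻¹ 1
  omega

end IsHypMetric

end Loxodromic

/-! ### Infinite subgroups contain loxodromic elements -/

section Existence

variable {G : Type*} [Group G] {d : G → G → ℕ} {D : ℕ}

namespace IsHypMetric

/-- Being loxodromic up to powers does not depend on the base point. -/
theorem exists_isLoxodromic_pow (hd : IsHypMetric d D) {k p : G}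
    (h : IsLoxodromic d D (p⁻¹ * k * p)) : ∃ m : ℕ, IsLoxodromic d D (k ^ m) := by
  have hconj : ∀ m : ℕ, d 1 ((p⁻¹ * k * p) ^ m) = d p (k ^ m * p) := fun m => by
    rw [hd.dist_eq_one p, ← mul_assoc]
    congr 1
    simpa using conj_pow (a := p⁻¹) (b := k) (i := m)
  have hle : ∀ m : ℕ, d p (k ^ m * p) ≤ d 1 (k ^ m) + 2 * d 1 p ∧
      d 1 (k ^ m) ≤ d p (k ^ m * p) + 2 * d 1 p := fun m => by
    have h1 := hd.triangle p 1 (k ^ m * p)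
    have h2 := hd.triangle 1 (k ^ m) (k ^ m * p)
    have h3 := hd.triangle 1 p (k ^ m)
    have h4 := hd.triangle p (k ^ m * p) (k ^ m)
    have h5 := hd.dist_mul_right (k ^ m) p
    have h6 := hd.comm (k ^ m * p) (k ^ m)
    have h7 := hd.comm p 1
    omega
  let m := 4 * d 1 p + d 1 (p⁻¹ * k * p) + D + (2 * D + 1)
  refine ⟨m, ?_⟩
  have h1 := hd.dist_one_pow_mono h (Nat.zero_le m)
  have h2 := hd.dist_one_pow_add_dist_one_pow h m m
  have h3 := (hle m).2
  have h4 := (hle (m * 2)).1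
  rw [mul_two m] at h4
  rw [IsLoxodromic, ← pow_mul, mul_two]
  rw [hconj, hconj] at h2
  rw [pow_zero, hd.self, hconj] at h1
  omega

/-- Without loxodromic elements, all elements of `H` displace by a bounded amount a point `p` far
out in the direction of `H`: they fix this direction, and a definite displacement along it would
be loxodromic. -/
theorem dist_mul_left_le_of_forall_not_isLoxodromic (hd : IsHypMetric d D) {H : Subgroup G}
    (hH : ∀ g ∈ H, ¬ IsLoxodromic d D g) {h k p : G} (hh : h ∈ H) (hk : k ∈ H)
    (hp : d 1 p + d p h = d 1 h) (hkp : d 1 k + D ≤ d 1 p)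
    (hph : 2 * d 1 p + 8 * d 1 k + 20 * D + 10 ≤ d 1 h) : d p (k * p) ≤ 7 * D := by
  have e1 : d p (k ^ 2 * p) ≤ d p (k * p) + 2 * D := by
    by_contra hcon
    obtain ⟨m, hm⟩ := hd.exists_isLoxodromic_pow (hd.isLoxodromic_conj (g := k) (x := p) (by omega))
    exact hH _ (H.pow_mem hk m) hm
  have e2 := hd.dist_le_max_of_forall_not_isLoxodromic hH hh (H.mul_mem hk hh)
  have t1 : d k (k * p) = d 1 p := hd.dist_mul_right _ _
  have t2 : d k (k * h) = d 1 h := hd.dist_mul_right _ _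
  have t3 : d (k * p) (k * h) = d p h := hd.left _ _ _
  have t4 : d (k * p) (k ^ 2 * p) = d p (k * p) := by rw [pow_two, mul_assoc, hd.left]
  have t5 : d (k ^ 2 * p) (k * h) = d (k * p) h := by rw [pow_two, mul_assoc, hd.left]
  have c1 := hd.comm (k * h) (k * p)
  have c2 := hd.comm (k * h) h
  have c3 := hd.comm h p
  have c4 := hd.comm h (k * p)
  have c5 := hd.comm (k * p) p
  have c6 := hd.comm (k * h) p
  have c7 := hd.comm (k * p) k
  have c8 := hd.comm (k ^ 2 * p) (k * p)
  have c9 := hd.comm h (k ^ 2 * p)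
  have c10 := hd.comm k 1
  have r1 := hd.triangle 1 k (k * h)
  have r2 := hd.triangle k 1 (k * h)
  have r3 := hd.triangle 1 k (k * p)
  have r4 := hd.triangle k 1 p
  have r6 := hd.triangle 1 k h
  -- The point `k * p` is hardly farther from `h` than `p` is, and `p` hardly farther from `k * h`
  -- than `k * p` is.
  have b1 : d (k * p) h ≤ d p h + d 1 k + D := by
    have := hd.four 1 (k * h) h (k * p)
    omega
  have b2 : d p (k * h) ≤ d p h + d 1 k + D := by
    have := hd.four k h (k * h) p
    omega
  have a1 := hd.four 1 h p (k * p)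
  have a2 := hd.four k (k * h) (k * p) p
  have s : d p (k * p) ≤ d 1 k + 2 * D := by omega
  -- Either `p` and `k * p` are close, or they differ by a shift along the direction of `H`.
  have a3 : 2 * d p (k * p) ≤ 3 * D ∨ d p (k * p) + d p h ≤ d (k * p) h + D ∨
      d p (k * p) + d p h ≤ d p (k * h) + D := by
    have := hd.four 1 (k * p) p k
    have := hd.comm p k
    omega
  -- Shifting twice displaces `p` twice as much.
  have r7 := hd.triangle p (k ^ 2 * p) h
  have r8 := hd.triangle (k ^ 2 * p) p h
  have r9 := hd.comm (k ^ 2 * p) p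
  have z : d p (k * p) + d h (k * h) + 4 * D < 2 * d p h := by omega
  rcases a3 with a3 | a3 | a3
  · omega
  · have f1 := hd.four (k * p) h (k ^ 2 * p) (k * h)
    have f2 : 2 * d (k * p) h ≤ d (k ^ 2 * p) h + d p h + D := by omega
    omega
  · have f1 := hd.four p (k * h) (k * p) h
    have f2 : d p (k * h) + d (k * p) h ≤ 2 * d p h + D := by omega
    have f3 := hd.four (k ^ 2 * p) h (k * p) (k * h)
    have f4 : d (k ^ 2 * p) h + d p h ≤ 2 * d (k * p) h + D := by omega
    omega

/-- Every infinite subgroup of a hyperbolic group contains a loxodromic element. -/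
theorem exists_isLoxodromic (hd : IsHypMetric d D) {H : Subgroup G} (hinf : (H : Set G).Infinite) :
    ∃ g ∈ H, IsLoxodromic d D g := by
  by_contra! hH
  have hball := hd.finite_ball (7 * D)
  obtain ⟨T, hTH, hT⟩ := hinf.exists_subset_card_eq (hball.toFinset.card + 1)
  -- Choose a point `p` far beyond `T`, in the first half of a geodesic to an element of `H`.
  let M := T.sup (d 1)
  have hM : ∀ k ∈ T, d 1 k ≤ M := fun k hk => Finset.le_sup (f := d 1) hk
  obtain ⟨h, hh, hhM⟩ : ∃ h ∈ H, 10 * M + 22 * D + 10 ≤ d 1 h := by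
    by_contra! hcon
    exact hinf ((hd.finite_ball (10 * M + 22 * D + 10)).subset fun h hh => (hcon h hh).le)
  obtain ⟨p, hpn, hp⟩ := hd.exists_between 1 h (M + D) (by omega)
  have hmaps : ∀ k ∈ T, p⁻¹ * k * p ∈ hball.toFinset := fun k hk => by
    have := hd.dist_mul_left_le_of_forall_not_isLoxodromic hH hh (hTH hk) hp
      (by have := hM k hk; omega) (by have := hM k hk; omega)
    rw [hd.dist_eq_one, ← mul_assoc] at this
    simpa using this
  have := Finset.card_le_card_of_injOn _ hmaps fun x _ y _ hxy => by simpa using hxy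
  omega

end IsHypMetric

end Existence

/-! ### The elementary subgroup of a loxodromic element -/

section Contracting

variable {G : Type*} [Group G] {d : G → G → ℕ} {D : ℕ}

/-- `p` is a projection of `x` to `Y`, up to the constant `C`: every geodesic from `x` to a point
of `Y` passes near `p`. -/
def IsProj (d : G → G → ℕ) (Y : Set G) (C : ℕ) (x p : G) : Prop :=
  p ∈ Y ∧ ∀ y ∈ Y, d x p + d p y ≤ d x y + C

/-- `Y` is contracting: every point has a projection to `Y`. -/
def IsContracting (d : G → G → ℕ) (Y : Set G) (C : ℕ) : Prop :=
  ∀ x, ∃ p, IsProj d Y C x p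

theorem IsProj.mul_left (hd : IsHypMetric d D) {H : Subgroup G} {C : ℕ} {x p h : G}
    (hp : IsProj d H C x p) (hh : h ∈ H) : IsProj d H C (h * x) (h * p) := by
  refine ⟨H.mul_mem hh hp.1, fun y hy => ?_⟩
  have := hp.2 (h⁻¹ * y) (H.mul_mem (H.inv_mem hh) hy)
  rw [← hd.left h p, ← hd.left h x (h⁻¹ * y), mul_inv_cancel_left] at this
  rwa [hd.left]

/-- Projections are coarsely Lipschitz. -/
theorem IsProj.dist_le (hd : IsHypMetric d D) {Y : Set G} {C : ℕ} {x y p q : G}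
    (hp : IsProj d Y C x p) (hq : IsProj d Y C y q) : d p q ≤ C + d x y := by
  have h1 := hp.2 q hq.1
  have h2 := hq.2 p hp.1
  have h3 := hd.triangle x y q
  have h4 := hd.triangle y x p
  have h5 := hd.comm y x
  have h6 := hd.comm q p
  omega

/-- If the projections of two points are far apart, a geodesic between the points passes near both
projections. -/
theorem IsProj.dist_add_dist_le (hd : IsHypMetric d D) {Y : Set G} {C : ℕ} {x y p q : G}
    (hp : IsProj d Y C x p) (hq : IsProj d Y C y q) (hpq : C + D < d p q) :
    d x p + d p q + d q y ≤ d x y + (2 * C + D) := by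
  have h1 := hp.2 q hq.1
  have h2 := hq.2 p hp.1
  have h3 := hd.four x q p y
  have h5 := hd.comm q p
  have h6 := hd.comm q y
  have h7 := hd.comm p y
  omega

namespace IsHypMetric

theorem dist_zpow_zpow (hd : IsHypMetric d D) (g : G) (i j : ℤ) :
    d (g ^ i) (g ^ j) = d 1 (g ^ (j - i).natAbs) := by
  rw [hd.dist_eq_one, ← zpow_neg, ← zpow_add]
  rcases le_total i j with h | h
  · rw [← zpow_natCast, show ((j - i).natAbs : ℤ) = -i + j by omega]
  · rw [← zpow_natCast, show ((j - i).natAbs : ℤ) = -(-i + j) by omega, zpow_neg, hd.dist_one_inv]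

theorem natAbs_le_dist_zpow (hd : IsHypMetric d D) {g : G} (hg : IsLoxodromic d D g) (i j : ℤ) :
    (j - i).natAbs ≤ d (g ^ i) (g ^ j) := by
  rw [hd.dist_zpow_zpow]
  have := hd.dist_one_pow_mono hg (Nat.zero_le (j - i).natAbs)
  omega

theorem dist_one_pow_le (hd : IsHypMetric d D) (g : G) (n : ℕ) : d 1 (g ^ n) ≤ n * d 1 g := by
  induction n with
  | zero => simp [hd.self]
  | succ n ih =>
    have h1 := hd.triangle 1 (g ^ n) (g ^ (n + 1))
    rw [pow_succ, hd.dist_mul_right] at h1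
    rw [pow_succ]
    linarith

theorem dist_zpow_add_dist_zpow (hd : IsHypMetric d D) {g : G} (hg : IsLoxodromic d D g)
    {i j k : ℤ} (hij : i ≤ j) (hjk : j ≤ k) :
    d (g ^ i) (g ^ j) + d (g ^ j) (g ^ k) ≤ d (g ^ i) (g ^ k) + (d 1 g + D) := by
  rw [hd.dist_zpow_zpow, hd.dist_zpow_zpow, hd.dist_zpow_zpow,
    show (k - i).natAbs = (j - i).natAbs + (k - j).natAbs by omega]
  exact hd.dist_one_pow_add_dist_one_pow hg _ _

theorem zpow_injective (hd : IsHypMetric d D) {g : G} (hg : IsLoxodromic d D g) :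
    Function.Injective (fun n : ℤ => g ^ n) := by
  intro i j hij
  have := hd.natAbs_le_dist_zpow hg i j
  simp only at hij
  rw [hij, hd.self] at this
  omega

/-- Nearest-point projections to the powers of a loxodromic element are projections. -/
theorem exists_isContracting_zpowers (hd : IsHypMetric d D) {g : G} (hg : IsLoxodromic d D g) :
    ∃ C, IsContracting d (Subgroup.zpowers g : Set G) C := by
  -- `m` is chosen so that `g ^ m` is far enough from `1` to rule out one case of the four-point
  -- inequality below.
  let m := d 1 g + 2 * D + 1
  have key : ∀ {γ : G}, IsLoxodromic d D γ → d 1 γ = d 1 g → ∀ (x p : G) (n : ℕ),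
      (∀ k : ℕ, d x p ≤ d x (p * γ ^ k)) →
      d x p + d p (p * γ ^ n) ≤ d x (p * γ ^ n) + (m * d 1 g + d 1 g + 2 * D) := by
    intro γ hγ hγg x p n hx
    have hm := hd.dist_one_pow_le γ m
    rw [hγg] at hm
    have h1 := hd.dist_mul_right p (γ ^ n)
    have h0 := hx n
    rcases le_total n m with hnm | hnm
    · have h2 := hd.dist_one_pow_mono hγ hnm
      omega
    · have h2 := hd.dist_one_pow_mono hγ (Nat.zero_le m)
      have h3 := hd.dist_one_pow_add_dist_one_pow hγ m (n - m)
      rw [Nat.add_sub_cancel' hnm, hγg] at h3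
      have h4 := hd.dist_mul_right p (γ ^ m)
      have h5 : d (p * γ ^ m) (p * γ ^ n) = d 1 (γ ^ (n - m)) := by
        rw [hd.left, ← hd.dist_mul_right (γ ^ m), ← pow_add, Nat.add_sub_cancel' hnm]
      have h6 := hd.four x (p * γ ^ m) p (p * γ ^ n)
      have h7 := hd.comm (p * γ ^ m) p
      have h9 := hx m
      omega
  refine ⟨m * d 1 g + d 1 g + 2 * D, fun x => ?_⟩
  obtain ⟨p, hpY, hp⟩ : ∃ p ∈ (Subgroup.zpowers g : Set G),
      ∀ y ∈ (Subgroup.zpowers g : Set G), d x p ≤ d x y := by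
    have hwf := (wellFounded_lt (α := ℕ)).has_min (d x '' (Subgroup.zpowers g : Set G))
      ⟨_, 1, Subgroup.one_mem _, rfl⟩
    obtain ⟨_, ⟨p, hp, rfl⟩, hmin⟩ := hwf
    exact ⟨p, hp, fun y hy => not_lt.1 (hmin _ ⟨y, hy, rfl⟩)⟩
  refine ⟨p, hpY, fun y hy => ?_⟩
  obtain ⟨n, hn⟩ := Subgroup.mem_zpowers_iff.1 ((Subgroup.zpowers g).mul_mem
    ((Subgroup.zpowers g).inv_mem hpY) hy)
  obtain ⟨n, rfl | rfl⟩ := n.eq_nat_or_neg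
  · have := key hg rfl x p n fun k => hp _ (Subgroup.mul_mem _ hpY (Subgroup.npow_mem_zpowers g k))
    rwa [← zpow_natCast, hn, mul_inv_cancel_left] at this
  · have := key (hd.isLoxodromic_inv hg) (hd.dist_one_inv g) x p n fun k =>
      hp _ (Subgroup.mul_mem _ hpY
        (Subgroup.pow_mem _ (Subgroup.inv_mem _ (Subgroup.mem_zpowers g)) k))
    rwa [inv_pow, ← zpow_natCast, ← zpow_neg, hn, mul_inv_cancel_left] at this

end IsHypMetric

/-- The elementary subgroup of `g`: the commensurator of the cyclic subgroup generated by `g`, for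
`g` of infinite order. -/
def elementary (g : G) : Subgroup G where
  carrier := {s | ∃ m n : ℤ, m ≠ 0 ∧ n ≠ 0 ∧ s * g ^ m * s⁻¹ = g ^ n}
  one_mem' := ⟨1, 1, one_ne_zero, one_ne_zero, by simp⟩
  mul_mem' := by
    rintro s t ⟨m, n, hm, hn, h⟩ ⟨a, b, ha, hb, h'⟩
    refine ⟨a * m, n * b, mul_ne_zero ha hm, mul_ne_zero hn hb, ?_⟩
    rw [zpow_mul g n, ← h, conj_zpow, ← zpow_mul g m, mul_comm m b, zpow_mul g b, ← h', conj_zpow,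
      ← zpow_mul]
    simp only [mul_inv_rev, mul_assoc]
  inv_mem' := by
    rintro s ⟨m, n, hm, hn, h⟩
    refine ⟨n, m, hn, hm, ?_⟩
    rw [← h]
    group

theorem zpow_mem_elementary (g : G) (n : ℤ) : g ^ n ∈ elementary g :=
  ⟨1, 1, one_ne_zero, one_ne_zero, by group⟩

namespace IsHypMetric

variable {g : G}

/-- If two points of `s⟨g⟩` have far apart projections `g ^ i` and `g ^ j` to `⟨g⟩`, then `s⟨g⟩`
passes near all powers of `g` in between. -/
theorem exists_dist_le_of_isProj (hd : IsHypMetric d D) (hg : IsLoxodromic d D g) {C : ℕ}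
    (hC : IsContracting d (Subgroup.zpowers g : Set G) C) {s : G} {a b i j k : ℤ}
    (hi : IsProj d (Subgroup.zpowers g : Set G) C (s * g ^ a) (g ^ i))
    (hj : IsProj d (Subgroup.zpowers g : Set G) C (s * g ^ b) (g ^ j))
    (hij : C + D < d (g ^ i) (g ^ j)) (hik : i ≤ k) (hkj : k ≤ j) :
    ∃ l : ℤ, d (g ^ k) (s * g ^ l) ≤ 4 * C + 2 * D + d 1 g := by
  obtain ⟨q, ⟨l, rfl⟩, hq⟩ := hC (s⁻¹ * g ^ k)
  refine ⟨l, ?_⟩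
  have h1 := hq (g ^ a) (Subgroup.zpow_mem_zpowers g a)
  have h2 := hq (g ^ b) (Subgroup.zpow_mem_zpowers g b)
  simp only [← hd.left s (s⁻¹ * g ^ k), mul_inv_cancel_left, ← hd.left s (g ^ l)] at h1 h2
  have h3 := hi.dist_add_dist_le hd hj hij
  have h4 := hd.dist_zpow_add_dist_zpow hg hik hkj
  have h5 := hd.triangle (g ^ k) (g ^ i) (s * g ^ a)
  have h6 := hd.triangle (g ^ k) (g ^ j) (s * g ^ b)
  have h7 := hd.triangle (s * g ^ a) (s * g ^ l) (s * g ^ b)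
  have h8 := hd.comm (s * g ^ a) (s * g ^ l)
  have h9 := hd.comm (g ^ i) (s * g ^ a)
  have h10 := hd.comm (g ^ k) (g ^ i)
  omega

/-- The translates of `⟨g⟩` by elements outside the elementary subgroup have uniformly bounded
projections to `⟨g⟩`: otherwise, by the pigeonhole principle, a power of `g` is conjugated to
another one. -/
theorem exists_dist_proj_le (hd : IsHypMetric d D) (hg : IsLoxodromic d D g) {C : ℕ}
    (hC : IsContracting d (Subgroup.zpowers g : Set G) C) :
    ∃ R, ∀ (s : G) (a b : ℤ) (p q : G), s ∉ elementary g →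
      IsProj d (Subgroup.zpowers g : Set G) C (s * g ^ a) p →
      IsProj d (Subgroup.zpowers g : Set G) C (s * g ^ b) q → d p q ≤ R := by
  have hball := hd.finite_ball (4 * C + 2 * D + d 1 g)
  let N := hball.toFinset.card
  refine ⟨C + D + N * d 1 g, fun s a b p q hs hp hq => ?_⟩
  obtain ⟨i, rfl⟩ := hp.1
  obtain ⟨j, rfl⟩ := hq.1
  simp only at hp hq ⊢
  wlog hij : i ≤ j generalizing i j a b with H
  · rw [hd.comm]
    exact H b a j hq i hp (by omega)
  by_contra! hcon
  have hN : N < (j - i).natAbs := by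
    by_contra! hle
    have h1 := hd.dist_one_pow_le g (j - i).natAbs
    have h2 := Nat.mul_le_mul_right (d 1 g) hle
    rw [← hd.dist_zpow_zpow] at h1
    omega
  choose! l hl using fun k (hk : k ∈ Finset.Icc i j) =>
    hd.exists_dist_le_of_isProj hg hC hp hq (by omega) (Finset.mem_Icc.1 hk).1
      (Finset.mem_Icc.1 hk).2
  have hmaps : ∀ k ∈ Finset.Icc i j, g ^ (-k) * (s * g ^ l k) ∈ hball.toFinset := fun k hk => by
    have := hl k hk
    rw [hd.dist_eq_one, ← zpow_neg] at this
    simpa using this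
  obtain ⟨k, hk, k', hk', hne, heq⟩ := Finset.exists_ne_map_eq_of_card_lt_of_maps_to
    (by rw [Int.card_Icc]; omega) hmaps
  have hconj : s * g ^ (l k - l k') * s⁻¹ = g ^ (k - k') := by
    rw [zpow_sub, zpow_sub]
    rw [zpow_neg, inv_mul_eq_iff_eq_mul] at heq
    rw [← mul_assoc, heq, zpow_neg]
    group
  refine hs ⟨_, _, fun h0 => ?_, sub_ne_zero.2 hne, hconj⟩
  rw [h0, zpow_zero, mul_one, mul_inv_cancel] at hconj
  exact sub_ne_zero.2 hne (hd.zpow_injective hg (by simpa using hconj.symm))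

/-- The elementary subgroup lies in a neighbourhood of `⟨g⟩`. -/
theorem exists_dist_zpow_le_of_mem_elementary (hd : IsHypMetric d D) (hg : IsLoxodromic d D g) :
    ∃ R, ∀ s ∈ elementary g, ∃ k : ℤ, d (g ^ k) s ≤ R := by
  obtain ⟨C, hC⟩ := hd.exists_isContracting_zpowers hg
  refine ⟨4 * C + 2 * D + d 1 g, fun s hs => ?_⟩
  obtain ⟨m, n, hm, hn, hmn⟩ := (elementary g).inv_mem hs
  -- The points `s⁻¹ * g ^ (m * N)` remain near the powers `g ^ (n * N)`.
  have hproj : ∀ N : ℤ, ∃ i : ℤ,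
      IsProj d (Subgroup.zpowers g : Set G) C (s⁻¹ * g ^ (m * N)) (g ^ i) ∧
      (i - n * N).natAbs ≤ C + d 1 s := by
    intro N
    obtain ⟨p, hp⟩ := hC (s⁻¹ * g ^ (m * N))
    obtain ⟨i, rfl⟩ := hp.1
    refine ⟨i, hp, ?_⟩
    have h1 := hp.2 _ (Subgroup.zpow_mem_zpowers g (n * N))
    have h2 := hd.natAbs_le_dist_zpow hg i (n * N)
    have h3 : s⁻¹ * g ^ (m * N) = g ^ (n * N) * s⁻¹ := by
      rw [zpow_mul, zpow_mul, ← hmn, conj_zpow]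
      group
    have h4 : d (s⁻¹ * g ^ (m * N)) (g ^ (n * N)) = d 1 s := by
      rw [h3, hd.comm, hd.dist_mul_right, hd.dist_one_inv]
    simp only at h1
    omega
  let T : ℕ := 2 * C + D + d 1 s + 1
  have hT : ∃ N N' : ℤ, (T : ℤ) ≤ n * N ∧ n * N' ≤ -T := by
    rcases lt_or_gt_of_ne hn with h | h
    · exact ⟨-T, T, by nlinarith, by nlinarith⟩
    · exact ⟨T, -T, by nlinarith, by nlinarith⟩
  obtain ⟨N, N', hN, hN'⟩ := hT
  obtain ⟨j, hj, hjN⟩ := hproj N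
  obtain ⟨i, hi, hiN⟩ := hproj N'
  have h1 := hd.natAbs_le_dist_zpow hg i j
  obtain ⟨l, hl⟩ := hd.exists_dist_le_of_isProj hg hC hi hj (by omega) (k := 0) (by omega)
    (by omega)
  refine ⟨l, ?_⟩
  rwa [zpow_zero, ← hd.left s, mul_inv_cancel_left, mul_one, hd.comm] at hl

end IsHypMetric

end Contracting

/-! ### The coarse projection onto an elementary subgroup -/

section Elementary

variable {G : Type*} [Group G] {d : G → G → ℕ} {D : ℕ}

namespace IsHypMetric

theorem finite_ball_subgroup (hd : IsHypMetric d D) (H : Subgroup G) (k : H) (n : ℕ) :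
    {h : H | d (k : G) (h : G) ≤ n}.Finite := by
  refine ((hd.finite_ball n).preimage (f := fun h : H => (k : G)⁻¹ * (h : G)) ?_).subset ?_
  · intro x _ y _ hxy
    exact Subtype.ext (mul_left_cancel hxy)
  · intro h hh
    rw [Set.mem_ofPred_eq, hd.dist_eq_one] at hh
    exact hh

variable {g : G}

/-- Projections to `⟨g⟩` are projections to the elementary subgroup. -/
theorem exists_isProj_elementary (hd : IsHypMetric d D) (hg : IsLoxodromic d D g) :
    ∃ C C', IsContracting d (Subgroup.zpowers g : Set G) C ∧ ∀ x p,
      IsProj d (Subgroup.zpowers g : Set G) C x p → IsProj d (elementary g : Set G) C' x p := by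
  obtain ⟨C, hC⟩ := hd.exists_isContracting_zpowers hg
  obtain ⟨R, hR⟩ := hd.exists_dist_zpow_le_of_mem_elementary hg
  refine ⟨C, C + 2 * R, hC, fun x p hp => ⟨?_, fun y hy => ?_⟩⟩
  · obtain ⟨k, rfl⟩ := hp.1
    exact zpow_mem_elementary g k
  · obtain ⟨k, hk⟩ := hR y hy
    have h1 := hp.2 _ (Subgroup.zpow_mem_zpowers g k)
    have h2 := hd.triangle p (g ^ k) y
    have h3 := hd.triangle x y (g ^ k)
    have h4 := hd.comm y (g ^ k)
    omega

/-- The cosets of the elementary subgroup other than itself have uniformly bounded projections. -/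
theorem exists_dist_proj_elementary_le (hd : IsHypMetric d D) (hg : IsLoxodromic d D g) :
    ∃ C R, IsContracting d (elementary g : Set G) C ∧ ∀ (s : G), s ∉ elementary g →
      ∀ k ∈ elementary g, ∀ p q : G, IsProj d (elementary g : Set G) C s p →
      IsProj d (elementary g : Set G) C (s * k) q → d p q ≤ R := by
  obtain ⟨C, C', hC, hCC'⟩ := hd.exists_isProj_elementary hg
  obtain ⟨R, hR⟩ := hd.exists_dist_zpow_le_of_mem_elementary hg
  obtain ⟨R', hR'⟩ := hd.exists_dist_proj_le hg hC
  refine ⟨C', C' + R' + C' + R, fun x => (hC x).imp fun p => hCC' x p,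
    fun s hs k hk p q hp hq => ?_⟩
  obtain ⟨l, hl⟩ := hR k hk
  obtain ⟨p', hp'⟩ := hC s
  obtain ⟨q', hq'⟩ := hC (s * g ^ l)
  have h1 := hR' s 0 l p' q' hs (by simpa using hp') hq'
  have h2 := hp.dist_le hd (hCC' _ _ hp')
  have h3 := (hCC' _ _ hq').dist_le hd hq
  rw [hd.left] at h3
  rw [hd.self] at h2
  have h4 := hd.triangle p p' q'
  have h5 := hd.triangle p q' q
  omega

/-- The nearest-point projection onto the elementary subgroup of a loxodromic element is a coarse
projection. -/
theorem exists_isCoarseProjection (hd : IsHypMetric d D) (hg : IsLoxodromic d D g) :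
    ∃ π : G → elementary g, IsCoarseProjection (elementary g) π := by
  obtain ⟨C, R, hC, hR⟩ := hd.exists_dist_proj_elementary_le hg
  obtain ⟨π, hequiv, hπ⟩ := exists_equivariant_choice
    (fun (x : G) (k : elementary g) => IsProj d (elementary g : Set G) C x k)
    (fun h x k hk => hk.mul_left hd h.2)
    (fun x => (hC x).elim fun p hp => ⟨⟨p, hp.1⟩, hp⟩)
  refine ⟨π, hequiv, ?_, fun t => ?_, fun s hs => ?_⟩
  · refine (hd.finite_ball_subgroup (elementary g) 1 R).subset ?_
    rintro _ ⟨x, hx, k, rfl⟩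
    have := hR x hx k k.2 _ _ (hπ x) (hπ (x * k))
    rw [hd.dist_eq_one] at this
    exact this
  · refine (hd.finite_ball_subgroup (elementary g) 1 (C + d 1 t)).subset ?_
    rintro _ ⟨x, rfl⟩
    have := (hπ x).dist_le hd (hπ (x * t))
    rw [hd.dist_mul_right, hd.dist_eq_one] at this
    exact this
  · refine ⟨_, _, hd.finite_ball_subgroup (elementary g) (π s⁻¹) (C + D + R),
      hd.finite_ball_subgroup (elementary g) (π s) (R + (2 * C + D)), fun x hx => ?_⟩
    -- Let `q` be the projection of `s * x`. If the projections of `x` and `s⁻¹ * q` are far apart,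
    -- a geodesic from `s * x` to `q` passes near `s * π x`, so that `q` is near the projection of
    -- the point `s * π x` of the coset of `s`.
    have h1 := hR s⁻¹ (by simpa using hs) (π (s * x)) (π (s * x)).2 _ _ (hπ _) (hπ _)
    have h2 := hR s hs (π x) (π x).2 _ _ (hπ _) (hπ _)
    have h3 := hd.triangle (π s⁻¹) (π (s⁻¹ * π (s * x))) (π x)
    have h4 := hd.comm (π (s⁻¹ * π (s * x))) (π x)
    simp only [Set.mem_ofPred_eq, not_le] at hx ⊢
    have h5 := (hπ x).dist_add_dist_le hd (hπ (s⁻¹ * π (s * x))) (by omega)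
    have h6 := hd.triangle (π x) (π (s⁻¹ * π (s * x))) (s⁻¹ * π (s * x))
    have h7 : d x (π x) = d (s * x) (s * π x) := (hd.left _ _ _).symm
    have h8 : d x (s⁻¹ * π (s * x)) = d (s * x) (π (s * x)) := by
      rw [← hd.left s, mul_inv_cancel_left]
    have h9 : d (π x : G) (s⁻¹ * π (s * x)) = d (s * π x) (π (s * x)) := by
      rw [← hd.left s, mul_inv_cancel_left]
    have h10 := (hπ (s * x)).2 _ (π (s * π x)).2
    have h11 := (hπ (s * π x)).2 _ (π (s * x)).2
    have h12 := hd.triangle (s * x) (s * π x) (π (s * π x))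
    have h13 := hd.comm (π (s * π x)) (π (s * x))
    have h14 := hd.triangle (π s) (π (s * π x)) (π (s * x))
    omega

end IsHypMetric

end Elementary

/-! ### Amenable subgroups -/

section Amenable

universe u

/-- Sets with infinitely many pairwise disjoint translates are null for every invariant mean. -/
theorem mean_eq_zero_of_disjoint_translates {Γ : Type u} [Group Γ] {μ : Set Γ → ℝ}
    (h0 : ∀ A, 0 ≤ μ A) (h1 : μ Set.univ = 1)
    (hadd : ∀ A B, Disjoint A B → μ (A ∪ B) = μ A + μ B)
    (hinv : ∀ (g : Γ) (A : Set Γ), μ ((fun x => g * x) '' A) = μ A) {U : Set Γ} {f : ℕ → Γ}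
    (hf : ∀ k l, k ≠ l → Disjoint ((fun x => f k * x) '' U) ((fun x => f l * x) '' U)) :
    μ U = 0 := by
  have hsum : ∀ n : ℕ, μ (⋃ k ∈ Finset.range n, (fun x => f k * x) '' U) = n * μ U := by
    intro n
    induction n with
    | zero =>
      have := hadd ∅ ∅ (by simp)
      simp only [Set.union_self] at this
      simp only [Finset.range_zero, Finset.notMem_empty, Set.iUnion_of_empty, Set.iUnion_empty,
        CharP.cast_eq_zero, zero_mul]
      linarith
    | succ n ih =>
      rw [Finset.range_add_one, Finset.set_biUnion_insert, hadd, ih, hinv]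
      · push_cast
        ring
      · simp only [Set.disjoint_iUnion_right]
        intro k hk
        exact hf _ _ (by simp only [Finset.mem_range] at hk; omega)
  have hle : ∀ A, μ A ≤ 1 := fun A => by
    have := hadd A Aᶜ disjoint_compl_right
    rw [Set.union_compl_self, h1] at this
    have := h0 Aᶜ
    linarith
  by_contra hne
  have hpos : 0 < μ U := lt_of_le_of_ne (h0 U) (Ne.symm hne)
  obtain ⟨n, hn⟩ := exists_nat_gt (1 / μ U)
  rw [div_lt_iff₀ hpos, ← hsum] at hn
  exact absurd (hle _) (not_le.2 hn)

/-- An amenable subgroup meeting `E` in an infinite set is contained in `E` if `G` has a coarse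
projection onto `E`: an element `s` of the difference would play ping-pong with `E`. -/
theorem IsCoarseProjection.le_of_isAmenable {G : Type u} [Group G] {E H : Subgroup G} {π : G → E}
    (hπ : IsCoarseProjection E π) (hH : IsAmenable H)
    (hinf : {e : E | (e : G) ∈ H}.Infinite) : H ≤ E := by
  obtain ⟨μ, h0, h1, hadd, hinv⟩ := hH
  intro s hs
  by_contra hsE
  obtain ⟨A, B, hA, hB, hAB⟩ := hπ.finite_left s hsE
  obtain ⟨f, hfH, hf⟩ := exists_pairwise_disjoint_translates hinf (hA.union hB)
  let U : Set H := {h | π h ∈ A ∪ B}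
  have hU : μ U = 0 := by
    refine mean_eq_zero_of_disjoint_translates h0 h1 hadd hinv (f := fun k => ⟨f k, hfH k⟩)
      fun k l hkl => ?_
    rw [Set.disjoint_left]
    rintro _ ⟨x, hx, rfl⟩ ⟨y, hy, hxy⟩
    refine hf k l hkl _ hx _ hy ?_
    rw [← hπ.equivariant, ← hπ.equivariant]
    exact congrArg (fun h : H => π (h : G)) hxy.symm
  have hmono : ∀ {A B : Set H}, A ⊆ B → μ A ≤ μ B := fun {A B} h => by
    have := hadd A (B \ A) disjoint_sdiff_self_right
    rw [Set.union_sdiff_cancel h] at this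
    have := h0 (B \ A)
    linarith
  have hUc : μ Uᶜ ≤ μ U := by
    rw [← hinv ⟨s, hs⟩ Uᶜ]
    apply hmono
    rintro _ ⟨x, hx, rfl⟩
    exact Or.inr (hAB x fun h => hx (Or.inl h))
  have := hadd U Uᶜ disjoint_compl_right
  rw [Set.union_compl_self, h1] at this
  linarith

/-- Amenability passes to overgroups of finite index. -/
theorem IsAmenable.of_finite_index {G : Type u} [Group G] {H E : Subgroup G} (hH : IsAmenable H)
    (hHE : H ≤ E) [Finite (E ⧸ H.subgroupOf E)] : IsAmenable E := by
  classical
  obtain ⟨μ, h0, h1, hadd, hinv⟩ := hH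
  have := Fintype.ofFinite (E ⧸ H.subgroupOf E)
  let φ : H →* E := Subgroup.inclusion hHE
  -- The mean of the part of `A` in the coset of `x`, transported to `H`.
  let m : Set E → E → ℝ := fun A x => μ {k | x * φ k ∈ A}
  have hm : ∀ A x y, (QuotientGroup.mk x : E ⧸ H.subgroupOf E) = QuotientGroup.mk y →
      m A x = m A y := by
    intro A x y hxy
    have hk : ((x⁻¹ * y : E) : G) ∈ H := Subgroup.mem_subgroupOf.1 (QuotientGroup.eq.1 hxy)
    let k : H := ⟨((x⁻¹ * y : E) : G), hk⟩
    have hφk : φ k = x⁻¹ * y := Subtype.ext rfl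
    simp only [m]
    rw [← hinv k {h | y * φ h ∈ A}]
    congr 1
    ext h
    simp only [Set.mem_ofPred_eq, Set.mem_image]
    constructor
    · intro hh
      exact ⟨k⁻¹ * h, by simpa [hφk, mul_assoc] using hh, by simp⟩
    · rintro ⟨h, hh, rfl⟩
      simpa [hφk, mul_assoc] using hh
  have hcard : (0 : ℝ) < Fintype.card (E ⧸ H.subgroupOf E) := by
    exact_mod_cast Fintype.card_pos
  refine ⟨fun A => (∑ c : E ⧸ H.subgroupOf E, m A c.out) / Fintype.card (E ⧸ H.subgroupOf E),
    fun A => ?_, ?_, fun A B hAB => ?_, fun g A => ?_⟩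
  · exact div_nonneg (Finset.sum_nonneg fun c _ => h0 _) hcard.le
  · simp [m, h1, hcard.ne']
  · rw [← add_div, ← Finset.sum_add_distrib]
    refine congrArg (· / (Fintype.card (E ⧸ H.subgroupOf E) : ℝ)) ?_
    refine Finset.sum_congr rfl fun c _ => ?_
    rw [← hadd]
    · rfl
    · rw [Set.disjoint_left]
      exact fun k hk hk' => Set.disjoint_left.1 hAB hk hk'
  · refine congrArg (· / (Fintype.card (E ⧸ H.subgroupOf E) : ℝ)) ?_
    refine Fintype.sum_equiv (MulAction.toPerm g⁻¹) _ _ fun c => ?_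
    have h2 : m ((fun x => g * x) '' A) c.out = m A (g⁻¹ * c.out) := by
      simp only [m]
      congr 1
      ext k
      simp [mul_assoc]
    rw [h2]
    apply hm
    rw [MulAction.toPerm_apply, QuotientGroup.out_eq']
    nth_rw 2 [← QuotientGroup.out_eq' c]
    rfl

end Amenable

section Main

universe u

/-- A maximal amenable infinite subgroup of a hyperbolic group is the elementary subgroup of each of
its loxodromic elements, and therefore admits a coarse projection. -/
theorem IsMaximalAmenable.exists_isCoarseProjection {G : Type u} [Group G] {H : Subgroup G}
    (hinf : (H : Set G).Infinite) (hG : IsHyperbolicGroup G) (hH : IsMaximalAmenable H) :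
    ∃ π : G → H, IsCoarseProjection H π := by
  obtain ⟨d, D, hd⟩ := hG.exists_isHypMetric
  obtain ⟨g, hgH, hg⟩ := hd.exists_isLoxodromic hinf
  obtain ⟨π, hπ⟩ := hd.exists_isCoarseProjection hg
  have hpow : {e : elementary g | (e : G) ∈ H}.Infinite := by
    refine Set.infinite_of_injective_forall_mem (α := ℤ)
      (f := fun n => ⟨g ^ n, zpow_mem_elementary g n⟩) (fun m n hmn => ?_) fun n => H.zpow_mem hgH n
    exact hd.zpow_injective hg (congrArg Subtype.val hmn)
  have hle : H ≤ elementary g := hπ.le_of_isAmenable hH.prop hpow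
  have hfin : Finite (elementary g ⧸ H.subgroupOf (elementary g)) := by
    obtain ⟨R, hR⟩ := hd.exists_dist_zpow_le_of_mem_elementary hg
    have hball := (hd.finite_ball_subgroup (elementary g) 1 R).image
      (QuotientGroup.mk : elementary g → elementary g ⧸ H.subgroupOf (elementary g))
    refine Set.finite_univ_iff.1 (hball.subset fun c _ => ?_)
    obtain ⟨s, rfl⟩ := QuotientGroup.mk_surjective c
    obtain ⟨k, hk⟩ := hR (s⁻¹ : elementary g) (s⁻¹).2
    refine ⟨s * ⟨g ^ k, zpow_mem_elementary g k⟩, ?_, ?_⟩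
    · rw [hd.dist_eq_one, ← hd.dist_one_inv] at hk
      simpa using hk
    · rw [QuotientGroup.eq, Subgroup.mem_subgroupOf]
      simpa using H.zpow_mem hgH k
  have heq : H = elementary g := hH.eq_of_le (hH.prop.of_finite_index hle) hle
  subst heq
  exact ⟨π, hπ⟩

end Main

end RelHyp

theorem mainTheorem6 {G : Type*} [Group G] (H : Subgroup G) (hH : (H : Set G).Infinite) :
    -- the hyperbolic case
    (RelHyp.IsHyperbolicGroup G → RelHyp.IsMaximalAmenable H →
      ∀ s t : G, s ∉ H → t ∉ H →
        ∃ F : Set G, RelHyp.IsRoaming H F ∧ (RelHyp.translate s Fᶜ t ∩ Fᶜ).Finite) ∧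
    -- the relatively hyperbolic case
    (∀ P : Set (Subgroup G), RelHyp.IsRelHyperbolic P → H ∈ P →
      ∀ s t : G, s ∉ H → t ∉ H →
        ∃ F : Set G, RelHyp.IsRoaming H F ∧ (RelHyp.translate s Fᶜ t ∩ Fᶜ).Finite ∧
          RelHyp.translate s Fᶜ t ∩ Fᶜ ⊆ (H : Set G) ∧
          RelHyp.translate s (F ∪ (H : Set G))ᶜ t ⊆ F ∪ (H : Set G)) := by
  have : Infinite H := hH.to_subtype
  constructor
  · intro hG hmax s t hs _
    obtain ⟨π, hπ⟩ := hmax.exists_isCoarseProjection hH hG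
    obtain ⟨F, hF, hfin, -⟩ := hπ.exists_roaming hs t
    exact ⟨F, hF, hfin⟩
  · intro P hP hHP s t hs _
    obtain ⟨π, hπ⟩ := hP.exists_isCoarseProjection hHP
    exact hπ.exists_roaming hs t
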